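/- **Model.** There are $T$ periods, $I$ demand types and $J$ supply types. The rewards are $r_{ijts}\ge 0$ and the arrival probabilities are $\lambda_{it}>0$, $\mu_{js}>0$, with $\sum_i\lambda_{it}\le 1$ and $\sum_j\mu_{js}\le 1$ for all periods $t,s$. Let $u_1,\dots,u_T,v_1,\dots,v_T,w_1,\dots,w_T$ be mutually independent random variables, uniform on $[0,1]$. Demand unit $(i,t)$ arrives iff $\Lambda_{it}=1$ and supply unit $(j,s)$ arrives iff $M_{js}=1$, where $$\Lambda_{it}=\mathbf 1\Big\{u_t\in\Big[\sum_{k<i}\lambda_{kt},\sum_{k\le i}\lambda_{kt}\Big)\Big\},\qquad M_{js}=\mathbf 1\Big\{v_s\in\Big[\sum_{k<j}\mu_{ks},\sum_{k\le j}\mu_{ks}\Big)\Big\}.$$ Let $S_t=(M_{js'})_{j,\,s'\le t}$. **Linear programs.** For $a=(a_{it})$ and $b=(b_{js})$, let $\mathrm{LP}(a,b)$ be the problem of maximizing $\sum_{i,j,t,s}x_{ijts}r_{ijts}$ subject to $\sum_{i,t}x_{ijts}\le b_{js}$, $\sum_{j,s}x_{ijts}\le a_{it}$, $0\le x_{ijts}\le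 a_{it}b_{js}$, and $x_{ijts}=0$ for $s>t$. The maximum offline reward $V^{OFF}(\Lambda,M)$ is the optimal value of $\mathrm{LP}(\Lambda,M)$. **Online algorithm.** Let $x^*$ be any optimal solution of $\mathrm{LP}(\lambda,\mu)$, and put $$p_{ijts}(S_t)=\frac{\min\big(\lambda_{it},\,Q_{it}\big)}{Q_{it}}\,M_{js}\frac{x^*_{ijts}}{\mu_{js}},\qquad Q_{it}=\sum_{j'=1}^J\sum_{s'=1}^{t}M_{j's'}\frac{x^*_{ij't s'}}{\mu_{j's'}}$$ (read as $0$ if $Q_{it}=0$), and $$h_{js}(S_t)=\mathbb E\left[\frac{\sum_{t'=t+1}^T\sum_{i}r_{ijt's}\,p_{ijt's}(S_{t'})}{2-\sum_{t'=1}^t\sum_i p_{ijt's}(S_{t'})}\,\Big|\,S_t\right].$$ When demand unit $(i,t)$ arrives, the algorithm uses $w_t$ to pick at most one supply unit, the unit $(j,s)$ being picked with probability $p_{ijts}(S_t)/\lambda_{it}$: the pairs $(j,s)$ are ordered lexicographically, and $(j,s)$ is picked iff $w_t$ lies in the half-open interval from the sum of the probabilities of the pairs before $(j,s)$ to the sum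 of those up to and including $(j,s)$. If $(j,s)$ is picked, has not yet been matched, and $r_{ijts}\ge h_{js}(S_t)$, then $(i,t)$ is matched to $(j,s)$ and the reward $r_{ijts}$ is earned; otherwise $(i,t)$ is rejected. Let $V^{ON}$ be the total reward earned. **Theorem.** $V^{ON}$ and $V^{OFF}(\Lambda,M)$ are integrable, and $$\mathbb E[V^{ON}]\ \ge\ \tfrac14\,\mathbb E\big[V^{OFF}(\Lambda,M)\big].$$ -/

import Mathlib

open MeasureTheory ProbabilityTheory

noncomputable section

/-- The indicator `1{u ∈ [∑_{b < a} q b, ∑_{b ≤ a} q b)}`. If `q ≥ 0`, `∑ q ≤ 1` and `u` is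
uniform on `[0,1]`, this samples at most one element of `α`, element `a` with probability `q a`. -/
def drawIndicator {α : Type*} [Fintype α] [LinearOrder α] (q : α → ℝ) (a : α) (u : ℝ) : ℝ :=
  (Set.Ico (∑ b with b < a, q b) (∑ b with b ≤ a, q b)).indicator 1 u

/-- Constraints of the assignment linear program with demand capacities `a i t` and supply
capacities `b j s`; `x i j t s` is the amount of demand `(i,t)` assigned to supply `(j,s)`.
With `a = λ`, `b = μ` it is the deterministic program; with `a = Λ`, `b = M` (the realized
arrivals) it is the offline matching program. -/
structure AssignmentFeasible {I J T : ℕ} (a : Fin I → Fin T → ℝ) (b : Fin J → Fin T → ℝ)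
    (x : Fin I → Fin J → Fin T → Fin T → ℝ) : Prop where
  supply : ∀ j s, ∑ i, ∑ t, x i j t s ≤ b j s
  demand : ∀ i t, ∑ j, ∑ s, x i j t s ≤ a i t
  pair : ∀ i j t s, x i j t s ≤ a i t * b j s
  causal : ∀ i j t s, t < s → x i j t s = 0
  nonneg : ∀ i j t s, 0 ≤ x i j t s

/-- The data of a two-sided matching market with `I` demand types, `J` supply types and `T`
periods: the rewards `r i j t s` and the arrival probabilities `lam i t`, `mu j s`. -/
structure Market (I J T : ℕ) where
  r : Fin I → Fin J → Fin T → Fin T → ℝ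
  lam : Fin I → Fin T → ℝ
  mu : Fin J → Fin T → ℝ
  r_nonneg : ∀ i j t s, 0 ≤ r i j t s
  lam_pos : ∀ i t, 0 < lam i t
  mu_pos : ∀ j s, 0 < mu j s
  sum_lam_le_one : ∀ t, ∑ i, lam i t ≤ 1
  sum_mu_le_one : ∀ s, ∑ j, mu j s ≤ 1

namespace Market

variable {I J T : ℕ} (K : Market I J T)

/-- Total reward of an assignment. -/
def objective (x : Fin I → Fin J → Fin T → Fin T → ℝ) : ℝ :=
  ∑ i, ∑ j, ∑ t, ∑ s, x i j t s * K.r i j t s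

/-- `x` is an optimal solution of the deterministic program (capacities `λ`, `μ`). -/
def IsOptimal (x : Fin I → Fin J → Fin T → Fin T → ℝ) : Prop :=
  AssignmentFeasible K.lam K.mu x ∧
    ∀ y, AssignmentFeasible K.lam K.mu y → K.objective y ≤ K.objective x

/-- The maximum offline reward for realized arrivals `a` (demand) and `b` (supply): the value of
the offline matching program. (The feasible set is compact and contains `0`.) -/
def offValue (a : Fin I → Fin T → ℝ) (b : Fin J → Fin T → ℝ) : ℝ :=
  sSup {c | ∃ x, AssignmentFeasible a b x ∧ c = K.objective x}

/-- `∑_{j'} ∑_{s' ≤ t} m_{j's'} x_{ij'ts'} / μ_{j's'}` for a supply path `m`. -/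
def routingMass (x : Fin I → Fin J → Fin T → Fin T → ℝ) (m : Fin J → Fin T → ℝ)
    (i : Fin I) (t : Fin T) : ℝ :=
  ∑ j', ∑ s' ∈ Finset.Iic t, m j' s' * (x i j' t s' / K.mu j' s')

/-- The probability `p_{ijts}(S_t)`. It is written as a function of the whole supply path `m`, but
when `x i j t s = 0` for `s > t`, it depends only on the arrivals up to period `t`. -/
def prob (x : Fin I → Fin J → Fin T → Fin T → ℝ) (m : Fin J → Fin T → ℝ)
    (i : Fin I) (j : Fin J) (t s : Fin T) : ℝ :=
  min (K.lam i t) (K.routingMass x m i t) / K.routingMass x m i t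
    * (m j s * (x i j t s / K.mu j s))

variable {Ω : Type*}

/-- Demand arrival indicator `Λ_{it}`, generated by the seed `u_t`. -/
def demandArr (u : Fin T → Ω → ℝ) (ω : Ω) (i : Fin I) (t : Fin T) : ℝ :=
  drawIndicator (fun k => K.lam k t) i (u t ω)

/-- Supply arrival indicator `M_{js}`, generated by the seed `v_s`. -/
def supplyArr (v : Fin T → Ω → ℝ) (ω : Ω) (j : Fin J) (s : Fin T) : ℝ :=
  drawIndicator (fun k => K.mu k s) j (v s ω)

/-- The maximum offline reward `V^OFF(Λ, M)`. -/
def rewardOff (u v : Fin T → Ω → ℝ) (ω : Ω) : ℝ :=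
  K.offValue (K.demandArr u ω) (K.supplyArr v ω)

/-- The σ-algebra generated by `S_t`, the supply arrivals in the periods `1, …, t`. -/
abbrev infoUpTo (v : Fin T → Ω → ℝ) (t : Fin T) : MeasurableSpace Ω :=
  MeasurableSpace.comap (fun ω (j : Fin J) (s : Finset.Iic t) => K.supplyArr v ω j s) inferInstance

/-- The threshold `h_{js}(S_t)` of the simulation-based threshold policy, with bound `1` on the
expected number of demand units sent to `(j,s)`. -/
def threshold [MeasurableSpace Ω] (P : Measure Ω) (x : Fin I → Fin J → Fin T → Fin T → ℝ)
    (v : Fin T → Ω → ℝ) (j : Fin J) (s t : Fin T) : Ω → ℝ :=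
  P[fun ω =>
      (∑ t' ∈ Finset.Ioi t, ∑ i, K.r i j t' s * K.prob x (K.supplyArr v ω) i j t' s) /
        (1 + 1 - ∑ t' ∈ Finset.Iic t, ∑ i, K.prob x (K.supplyArr v ω) i j t' s)
    | K.infoUpTo v t]

/-- `X_{ijts} = 1`: demand unit `(i,t)` arrives and the separation step, using the seed `w_t`, picks
the supply unit `(j,s)`, which has probability `p_{ijts}(S_t) / λ_{it}`. -/
def Picked (x : Fin I → Fin J → Fin T → Fin T → ℝ) (u v w : Fin T → Ω → ℝ) (ω : Ω)
    (i : Fin I) (j : Fin J) (t s : Fin T) : Prop :=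
  K.demandArr u ω i t = 1 ∧
    drawIndicator
      (fun c : Fin J ×ₗ Fin T =>
        K.prob x (K.supplyArr v ω) i (ofLex c).1 t (ofLex c).2 / K.lam i t)
      (toLex (j, s)) (w t ω) = 1

/-- Supply unit `(j,s)` has not been matched in any of the first `n` periods. -/
def Available [MeasurableSpace Ω] (P : Measure Ω) (x : Fin I → Fin J → Fin T → Fin T → ℝ)
    (u v w : Fin T → Ω → ℝ) (ω : Ω) (j : Fin J) (s : Fin T) : ℕ → Prop
  | 0 => True
  | n + 1 => Available P x u v w ω j s n ∧
      ∀ (hn : n < T) (i : Fin I),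
        ¬ (K.Picked x u v w ω i j ⟨n, hn⟩ s ∧ Available P x u v w ω j s n ∧
            K.threshold P x v j s ⟨n, hn⟩ ω ≤ K.r i j ⟨n, hn⟩ s)

/-- The algorithm matches demand unit `(i,t)` to supply unit `(j,s)`: the separation step sends
`(i,t)` to `(j,s)`, `(j,s)` is still available, and the reward reaches the threshold. -/
def Matched [MeasurableSpace Ω] (P : Measure Ω) (x : Fin I → Fin J → Fin T → Fin T → ℝ)
    (u v w : Fin T → Ω → ℝ) (ω : Ω) (i : Fin I) (j : Fin J) (t s : Fin T) : Prop :=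
  K.Picked x u v w ω i j t s ∧ K.Available P x u v w ω j s t ∧
    K.threshold P x v j s t ω ≤ K.r i j t s

open Classical in
/-- The total reward `V^ON` of the online matching algorithm run with the LP solution `x`. -/
def rewardOn [MeasurableSpace Ω] (P : Measure Ω) (x : Fin I → Fin J → Fin T → Fin T → ℝ)
    (u v w : Fin T → Ω → ℝ) (ω : Ω) : ℝ :=
  ∑ i, ∑ j, ∑ t, ∑ s, if K.Matched P x u v w ω i j t s then K.r i j t s else 0

end Market

end

/-! The constant 1/4 is the product of two losses of a factor 1/2, both measured against the value
of the deterministic program.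

That value dominates the expected offline reward: averaging (nearly) optimal offline solutions over
the arrivals gives a point feasible for capacities λ, μ, where the pair constraint survives because
demand and supply are independent (`integral_rewardOff_le`).

The first half is lost in routing. Write Q for the routing mass of (i,t). The cap min(λ,Q)/Q lies
above 1 - Q/(4λ), the tangent to λ/Q at Q = 2λ. Given that (j,s) arrives, Q has mean at most λ + x/μ
≤ 2λ, by the demand and pair constraints. Hence E[p] ≥ x/2 (`le_prob`,
`integral_supplyArr_mul_routingMass_le`, `half_le_integral_prob`).

The second half is lost by a single supply unit facing its proposals. Their probabilities are
correlated through the supply path, but along every path they sum to at most 1. A potential argument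
then shows that the thresholds collect half of the proposed reward (`half_le_integral_survival`).

The prophet bound is stated with a product of conditional non-acceptance probabilities. It is
transferred to the algorithm by integrating out the fresh seeds u_t and w_t period by period, with
the whole supply path held fixed (`integral_mul_picked`, `integral_mul_survival_le`). -/

noncomputable section

/-! ### Sampling from a finite set with a uniform seed -/

section Draw

variable {α : Type*} [Fintype α] [LinearOrder α]

lemma sum_le_eq_sum_lt_add (q : α → ℝ) (a : α) :
    ∑ b with b ≤ a, q b = (∑ b with b < a, q b) + q a := by
  have : (Finset.univ.filter fun b => b ≤ a) = insert a (Finset.univ.filter fun b => b < a) := by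
    ext b
    simp [le_iff_eq_or_lt]
  rw [this, Finset.sum_insert (by simp), add_comm]

lemma sum_le_le_sum_lt {q : α → ℝ} (hq : ∀ a, 0 ≤ q a) {a b : α} (hab : a < b) :
    ∑ c with c ≤ a, q c ≤ ∑ c with c < b, q c :=
  Finset.sum_le_sum_of_subset_of_nonneg
    (fun c hc => by simpa using (Finset.mem_filter.1 hc).2.trans_lt hab) fun c _ _ => hq c

lemma drawIndicator_eq_ite (q : α → ℝ) (a : α) (u : ℝ) :
    drawIndicator q a u =
      if (∑ b with b < a, q b) ≤ u ∧ u < ∑ b with b ≤ a, q b then 1 else 0 := by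
  simp [drawIndicator, Set.indicator_apply]

lemma drawIndicator_eq_zero_or_one (q : α → ℝ) (a : α) (u : ℝ) :
    drawIndicator q a u = 0 ∨ drawIndicator q a u = 1 := by
  rw [drawIndicator_eq_ite]
  split_ifs <;> simp

lemma drawIndicator_nonneg (q : α → ℝ) (a : α) (u : ℝ) : 0 ≤ drawIndicator q a u := by
  rcases drawIndicator_eq_zero_or_one q a u with h | h <;> simp [h]

lemma drawIndicator_le_one (q : α → ℝ) (a : α) (u : ℝ) : drawIndicator q a u ≤ 1 := by
  rcases drawIndicator_eq_zero_or_one q a u with h | h <;> simp [h]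

lemma drawIndicator_mul_self (q : α → ℝ) (a : α) (u : ℝ) :
    drawIndicator q a u * drawIndicator q a u = drawIndicator q a u := by
  rcases drawIndicator_eq_zero_or_one q a u with h | h <;> simp [h]

/-- Distinct elements own disjoint intervals. Applied to two supply types in one period, this makes
their arrivals mutually exclusive. -/
lemma drawIndicator_mul_eq_zero {q : α → ℝ} (hq : ∀ a, 0 ≤ q a) {a b : α} (hab : a ≠ b) (u : ℝ) :
    drawIndicator q a u * drawIndicator q b u = 0 := by
  simp only [drawIndicator_eq_ite]
  rcases lt_or_gt_of_ne hab with h | h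
  · have := sum_le_le_sum_lt hq h
    split_ifs with h1 h2 <;> first | (exfalso; linarith [h1.1, h1.2, h2.1, h2.2]) | simp
  · have := sum_le_le_sum_lt hq h
    split_ifs with h1 h2 <;> first | (exfalso; linarith [h1.1, h1.2, h2.1, h2.2]) | simp

lemma measurable_drawIndicator {Ω : Type*} {m : MeasurableSpace Ω} {q : Ω → α → ℝ} {X : Ω → ℝ}
    (hq : ∀ a, Measurable fun ω => q ω a) (hX : Measurable X) (a : α) :
    Measurable fun ω => drawIndicator (q ω) a (X ω) := by
  simp only [drawIndicator_eq_ite]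
  refine Measurable.ite ?_ measurable_const measurable_const
  exact (measurableSet_le (Finset.measurable_sum _ fun b _ => hq b) hX).inter
    (measurableSet_lt hX (Finset.measurable_sum _ fun b _ => hq b))

lemma integral_uniform_Ico {a b : ℝ} (ha : 0 ≤ a) (hab : a ≤ b) (hb : b ≤ 1) (z : ℝ) :
    ∫ y in Set.Icc (0 : ℝ) 1, z * (Set.Ico a b).indicator 1 y = z * (b - a) := by
  rw [integral_const_mul, integral_indicator_one measurableSet_Ico, measureReal_def,
    Measure.restrict_apply measurableSet_Ico,
    Set.inter_eq_left.2 (show Set.Ico a b ⊆ Set.Icc 0 1 from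
      fun y hy => ⟨ha.trans hy.1, hy.2.le.trans hb⟩), Real.volume_Ico,
    ENNReal.toReal_ofReal (sub_nonneg.2 hab)]

/-- If the seed `X` is uniform and independent of `m`, drawing with `m`-measurable probabilities `q`
selects `a` with conditional probability `q a` given `m`. -/
lemma integral_mul_drawIndicator {Ω : Type*} {m m0 : MeasurableSpace Ω} {P : Measure Ω}
    [IsProbabilityMeasure P] (hm : m ≤ m0) {X : Ω → ℝ} (hX : Measurable X)
    (hunif : P.map X = volume.restrict (Set.Icc 0 1))
    (hind : Indep (MeasurableSpace.comap X inferInstance) m P)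
    {q : Ω → α → ℝ} (hq : ∀ a, Measurable[m] fun ω => q ω a) (hq0 : ∀ ω a, 0 ≤ q ω a)
    (hq1 : ∀ ω, ∑ a, q ω a ≤ 1) {Z : Ω → ℝ} (hZ : Measurable[m] Z) {C : ℝ}
    (hC : ∀ ω, |Z ω| ≤ C) (a : α) :
    ∫ ω, Z ω * drawIndicator (q ω) a (X ω) ∂P = ∫ ω, Z ω * q ω a ∂P := by
  -- The integrand sees `m` only through `Z` and the two interval endpoints. Packed into one vector
  -- independent of `X`, they turn the claim into Fubini on a product measure, the inner integral
  -- being the length of an interval.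
  let Y : Ω → ℝ × ℝ × ℝ := fun ω => (Z ω, ∑ b with b < a, q ω b, ∑ b with b ≤ a, q ω b)
  have hYm : Measurable[m] Y :=
    hZ.prodMk ((Finset.measurable_sum _ fun b _ => hq b).prodMk
      (Finset.measurable_sum _ fun b _ => hq b))
  have hY : Measurable Y := hYm.mono hm le_rfl
  have hXY : IndepFun X Y P :=
    (IndepFun_iff_Indep X Y P).2 (indep_of_indep_of_le_right hind hYm.comap_le)
  let g : ℝ × ℝ × ℝ × ℝ → ℝ := fun z => z.2.1 * if z.2.2.1 ≤ z.1 ∧ z.1 < z.2.2.2 then 1 else 0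
  have hg : Measurable g := by
    refine Measurable.mul (by fun_prop) (Measurable.ite ?_ measurable_const measurable_const)
    exact (measurableSet_le (measurable_fst.comp (measurable_snd.comp measurable_snd))
        measurable_fst).inter
      (measurableSet_lt measurable_fst (measurable_snd.comp (measurable_snd.comp measurable_snd)))
  have hmap := (indepFun_iff_map_prod_eq_prod_map_map hX.aemeasurable hY.aemeasurable).1 hXY
  have hgi : Integrable (fun ω => g (X ω, Y ω)) P := by
    refine Integrable.of_bound (hg.comp (hX.prodMk hY)).aestronglyMeasurable C (ae_of_all _ ?_)
    intro ω
    have := hC ω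
    have h0 := abs_nonneg (Z ω)
    simp only [g, Y, Real.norm_eq_abs, abs_mul]
    split_ifs <;> simp <;> linarith
  have hgi' : Integrable g ((P.map X).prod (P.map Y)) := by
    rw [← hmap, integrable_map_measure hg.aestronglyMeasurable (hX.prodMk hY).aemeasurable]
    exact hgi
  have : IsProbabilityMeasure (P.map X) := Measure.isProbabilityMeasure_map hX.aemeasurable
  have : IsProbabilityMeasure (P.map Y) := Measure.isProbabilityMeasure_map hY.aemeasurable
  calc ∫ ω, Z ω * drawIndicator (q ω) a (X ω) ∂P = ∫ ω, g (X ω, Y ω) ∂P := by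
        simp only [drawIndicator_eq_ite, g, Y]
    _ = ∫ z, g z ∂(P.map X).prod (P.map Y) := by
        rw [← hmap, integral_map (hX.prodMk hY).aemeasurable hg.aestronglyMeasurable]
    _ = ∫ y, ∫ t, g (t, y) ∂P.map X ∂P.map Y := integral_prod_symm g hgi'
    _ = ∫ ω, ∫ t, g (t, Y ω) ∂P.map X ∂P :=
        integral_map hY.aemeasurable
          (hg.stronglyMeasurable.integral_prod_left (μ := P.map X)).aestronglyMeasurable
    _ = ∫ ω, Z ω * q ω a ∂P := by
        refine integral_congr_ae (ae_of_all _ fun ω => ?_)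
        have hle : ∑ b with b < a, q ω b ≤ ∑ b with b ≤ a, q ω b := by
          rw [sum_le_eq_sum_lt_add]; linarith [hq0 ω a]
        have := integral_uniform_Ico (Finset.sum_nonneg fun b _ => hq0 ω b) hle
          ((Finset.sum_le_univ_sum_of_nonneg (hq0 ω)).trans (hq1 ω)) (Z ω)
        rw [sum_le_eq_sum_lt_add, add_sub_cancel_left] at this
        beta_reduce
        rw [← this, hunif]
        simp [g, Y, Set.indicator_apply, sum_le_eq_sum_lt_add]

end Draw

end

/-! ### The prophet inequality with correlated proposal probabilities -/

noncomputable section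

section Prophet

variable {Ω : Type*} {m0 : MeasurableSpace Ω} {P : Measure Ω} [IsProbabilityMeasure P]

lemma integral_mul_condExp {m : MeasurableSpace Ω} (hm : m ≤ m0) {f g : Ω → ℝ}
    (hf : Measurable[m] f) (hg : Integrable g P) {C : ℝ} (hC : ∀ ω, |f ω| ≤ C) :
    ∫ ω, f ω * P[g | m] ω ∂P = ∫ ω, f ω * g ω ∂P := by
  have h := condExp_stronglyMeasurable_mul_of_bound hm (μ := P) hf.stronglyMeasurable hg C
    (ae_of_all _ hC)
  calc ∫ ω, f ω * P[g | m] ω ∂P = ∫ ω, P[f * g | m] ω ∂P := integral_congr_ae h.symm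
    _ = ∫ ω, f ω * g ω ∂P := integral_condExp hm

variable {T : ℕ} {ι : Type*} [Fintype ι]

open Classical in
/-- Probability that a unit is still unmatched after `n` periods, when in period `t` candidate `i`
is proposed with probability `p t i` and accepted iff `h t ≤ r t i`. -/
def survival (r : Fin T → ι → ℝ) (p : Fin T → ι → Ω → ℝ) (h : Fin T → Ω → ℝ) (ω : Ω) : ℕ → ℝ
  | 0 => 1
  | n + 1 =>
    if hn : n < T then
      survival r p h ω n *
        (1 - ∑ i, p ⟨n, hn⟩ i ω * if h ⟨n, hn⟩ ω ≤ r ⟨n, hn⟩ i then 1 else 0)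
    else survival r p h ω n

lemma survival_succ (r : Fin T → ι → ℝ) (p : Fin T → ι → Ω → ℝ) (h : Fin T → Ω → ℝ) (ω : Ω)
    (t : Fin T) : survival r p h ω (t + 1) = survival r p h ω t *
        (1 - ∑ i, p t i ω * if h t ω ≤ r t i then 1 else 0) := by
  rw [survival, dif_pos t.2]

lemma survival_mem_Icc {r : Fin T → ι → ℝ} {p : Fin T → ι → Ω → ℝ} {h : Fin T → Ω → ℝ}
    (hp0 : ∀ t i ω, 0 ≤ p t i ω) (hp1 : ∀ t ω, ∑ i, p t i ω ≤ 1) (ω : Ω) (n : ℕ) :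
    survival r p h ω n ∈ Set.Icc (0 : ℝ) 1 := by
  induction n with
  | zero => simp [survival]
  | succ n ih =>
    rw [survival]
    split_ifs with hn
    · have h0 : 0 ≤ ∑ i, p ⟨n, hn⟩ i ω * (if h ⟨n, hn⟩ ω ≤ r ⟨n, hn⟩ i then (1 : ℝ) else 0) :=
        Finset.sum_nonneg fun i _ => mul_nonneg (hp0 _ i ω) (by split_ifs <;> simp)
      have h1 : ∑ i, p ⟨n, hn⟩ i ω * (if h ⟨n, hn⟩ ω ≤ r ⟨n, hn⟩ i then (1 : ℝ) else 0) ≤ 1 :=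
        (Finset.sum_le_sum fun i _ =>
          mul_le_of_le_one_right (hp0 _ i ω) (by split_ifs <;> simp)).trans (hp1 ⟨n, hn⟩ ω)
      exact ⟨mul_nonneg ih.1 (by linarith), mul_le_one₀ ih.2 (by linarith) (by linarith)⟩
    · exact ih

/-- Only periods before `n` enter. The restriction `t < n` is what makes survival through period `t`
known at time `t`, before later supply is revealed. -/
lemma measurable_survival {r : Fin T → ι → ℝ} {p : Fin T → ι → Ω → ℝ} {h : Fin T → Ω → ℝ}
    {m : MeasurableSpace Ω} (n : ℕ) (hp : ∀ t : Fin T, t < n → ∀ i, Measurable[m] (p t i))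
    (hh : ∀ t : Fin T, t < n → Measurable[m] (h t)) :
    Measurable[m] fun ω => survival r p h ω n := by
  induction n with
  | zero => exact measurable_const
  | succ n ih =>
    have ih' := ih (fun t ht => hp t (by omega)) (fun t ht => hh t (by omega))
    simp only [survival]
    by_cases hn : n < T
    · simp only [hn, dif_pos]
      refine ih'.mul (measurable_const.sub (Finset.measurable_sum _ fun i _ =>
        (hp ⟨n, hn⟩ (by simp) i).mul (Measurable.ite ?_ measurable_const measurable_const)))
      exact measurableSet_le (hh ⟨n, hn⟩ (by simp)) measurable_const
    · simpa only [hn, dif_neg, not_false_eq_true] using ih'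

lemma filter_le_eq_insert (t : Fin T) :
    (Finset.univ.filter fun s : Fin T => (t : ℕ) ≤ s) =
      insert t (Finset.univ.filter fun s : Fin T => (t : ℕ) + 1 ≤ s) := by
  ext s
  simp only [Finset.mem_filter, Finset.mem_univ, true_and, Finset.mem_insert, Fin.ext_iff]
  omega

lemma filter_lt_succ_eq_insert (t : Fin T) :
    (Finset.univ.filter fun s : Fin T => (s : ℕ) < t + 1) =
      insert t (Finset.univ.filter fun s : Fin T => (s : ℕ) < t) := by
  ext s
  simp only [Finset.mem_filter, Finset.mem_univ, true_and, Finset.mem_insert, Fin.ext_iff]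
  omega

open Classical in
/-- Prophet inequality with correlated arrival probabilities: accepting above the threshold
`E[future reward / (2 - past arrival probability) | ℱ t]` earns half of the total expected
reward. -/
theorem half_le_integral_survival {ℱ : Fin T → MeasurableSpace Ω} (hmono : Monotone ℱ)
    (hle : ∀ t, ℱ t ≤ m0) {r : Fin T → ι → ℝ} (hr : ∀ t i, 0 ≤ r t i)
    {p : Fin T → ι → Ω → ℝ} (hp : ∀ t i, Measurable[ℱ t] (p t i)) (hp0 : ∀ t i ω, 0 ≤ p t i ω)
    (hsum : ∀ ω, ∑ t, ∑ i, p t i ω ≤ 1) {h : Fin T → Ω → ℝ}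
    (hh : ∀ t, h t = P[fun ω => (∑ s ∈ Finset.Ioi t, ∑ i, r s i * p s i ω) /
      (1 + 1 - ∑ s ∈ Finset.Iic t, ∑ i, p s i ω) | ℱ t]) :
    1 / 2 * ∫ ω, ∑ t, ∑ i, r t i * p t i ω ∂P ≤
      ∫ ω, ∑ t, ∑ i, r t i * (survival r p h ω t * p t i ω * if h t ω ≤ r t i then 1 else 0) ∂P := by
  have hpm : ∀ t i, Measurable (p t i) := fun t i => (hp t i).mono (hle t) le_rfl
  have hhm : ∀ t, Measurable[ℱ t] (h t) := fun t => by
    rw [hh t]; exact stronglyMeasurable_condExp.measurable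
  have hhi : ∀ t, Integrable (h t) P := fun t => by rw [hh t]; exact integrable_condExp
  have hPt : ∀ t ω, 0 ≤ ∑ i, p t i ω := fun t ω => Finset.sum_nonneg fun i _ => hp0 t i ω
  have hp1 : ∀ t ω, ∑ i, p t i ω ≤ 1 := fun t ω =>
    (Finset.single_le_sum (f := fun t => ∑ i, p t i ω) (fun t _ => hPt t ω)
      (Finset.mem_univ t)).trans (hsum ω)
  have hpi1 : ∀ t i ω, p t i ω ≤ 1 := fun t i ω =>
    (Finset.single_le_sum (f := fun i => p t i ω) (fun i _ => hp0 t i ω)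
      (Finset.mem_univ i)).trans (hp1 t ω)
  let A : ℕ → Ω → ℝ := fun n ω => survival r p h ω n
  have hA : ∀ n ω, A n ω ∈ Set.Icc (0 : ℝ) 1 := fun n ω => survival_mem_Icc hp0 hp1 ω n
  -- The range reaches `n = t + 1`: acceptance probabilities in period `t` are already known under
  -- `ℱ t`. This later lets `A (t + 1)` be moved inside the conditional expectation defining `h t`.
  have hAm : ∀ n, ∀ t : Fin T, n ≤ (t : ℕ) + 1 → Measurable[ℱ t] (A n) := fun n t hnt =>
    measurable_survival n
      (fun s hs i => (hp s i).mono (hmono (Fin.le_def.2 (by omega))) le_rfl)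
      (fun s hs => (hhm s).mono (hmono (Fin.le_def.2 (by omega))) le_rfl)
  have hAm0 : ∀ n, Measurable (A n) := fun n => measurable_survival n (fun s _ i => hpm s i)
    fun s _ => (hhm s).mono (hle s) le_rfl
  -- `D n` is the proposal probability spent before period `n`, and `R n` is the reward still to be
  -- proposed from period `n` on.
  let D : ℕ → Ω → ℝ := fun n ω => ∑ s ∈ Finset.univ.filter fun s : Fin T => (s : ℕ) < n, ∑ i, p s i ω
  let R : ℕ → Ω → ℝ := fun n ω => ∑ s ∈ Finset.univ.filter fun s : Fin T => n ≤ (s : ℕ), ∑ i, r s i * p s i ω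
  let W : Fin T → Ω → ℝ := fun t ω =>
    ∑ i, r t i * (A t ω * p t i ω * if h t ω ≤ r t i then 1 else 0)
  have hD0 : ∀ n ω, 0 ≤ D n ω := fun n ω => Finset.sum_nonneg fun s _ => hPt s ω
  have hD1 : ∀ n ω, D n ω ≤ 1 := fun n ω =>
    (Finset.sum_le_univ_sum_of_nonneg fun s => hPt s ω).trans (hsum ω)
  have hDm : ∀ n, Measurable (D n) := fun n =>
    Finset.measurable_sum _ fun s _ => Finset.measurable_sum _ fun i _ => hpm s i
  have hDmt : ∀ t : Fin T, Measurable[ℱ t] (D t) := fun t =>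
    Finset.measurable_sum _ fun s hs => Finset.measurable_sum _ fun i _ =>
      (hp s i).mono (hmono (Fin.le_def.2 (Finset.mem_filter.1 hs).2.le)) le_rfl
  have hRm : ∀ n, Measurable (R n) := fun n =>
    Finset.measurable_sum _ fun s _ => Finset.measurable_sum _ fun i _ => (hpm s i).const_mul _
  have hR0 : ∀ n ω, 0 ≤ R n ω := fun n ω => Finset.sum_nonneg fun s _ =>
    Finset.sum_nonneg fun i _ => mul_nonneg (hr s i) (hp0 s i ω)
  let C : ℝ := ∑ s, ∑ i, r s i
  have hRC : ∀ n ω, R n ω ≤ C := fun n ω =>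
    (Finset.sum_le_univ_sum_of_nonneg fun s =>
      Finset.sum_nonneg fun i _ => mul_nonneg (hr s i) (hp0 s i ω)).trans
    (Finset.sum_le_sum fun s _ => Finset.sum_le_sum fun i _ =>
      mul_le_of_le_one_right (hr s i) (hpi1 s i ω))
  have hC0 : 0 ≤ C := Finset.sum_nonneg fun s _ => Finset.sum_nonneg fun i _ => hr s i
  -- Since D ≤ 1, the weight θ lies in [0,1]; it serves as the acceptance probability of a
  -- randomized comparison rule.
  let θ : ℕ → Ω → ℝ := fun n ω => (2 - D n ω)⁻¹
  have hθ0 : ∀ n ω, 0 ≤ θ n ω := fun n ω => inv_nonneg.2 (by linarith [hD1 n ω])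
  have hθ1 : ∀ n ω, θ n ω ≤ 1 := fun n ω => inv_le_one_of_one_le₀ (by linarith [hD1 n ω])
  have hθm : ∀ n, Measurable (θ n) := fun n => ((hDm n).const_sub 2).inv
  -- The potential is A·g. It starts at half of the total proposed reward, because D = 0 and θ = 1/2
  -- at time 0, and it ends at 0.
  let g : ℕ → Ω → ℝ := fun n ω => θ n ω * R n ω
  have hgb : ∀ n ω, |g n ω| ≤ C := fun n ω => by
    rw [abs_of_nonneg (mul_nonneg (hθ0 n ω) (hR0 n ω))]
    exact (mul_le_of_le_one_left (hR0 n ω) (hθ1 n ω)).trans (hRC n ω)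
  have hgm : ∀ n, Measurable (g n) := fun n => (hθm n).mul (hRm n)
  have hgi : ∀ n, Integrable (g n) P := fun n =>
    Integrable.of_bound (hgm n).aestronglyMeasurable C (ae_of_all _ (hgb n))
  have hAb : ∀ n ω, |A n ω| ≤ 1 := fun n ω => by
    rw [abs_of_nonneg (hA n ω).1]; exact (hA n ω).2
  have hAgi : ∀ n, Integrable (fun ω => A n ω * g n ω) P := fun n =>
    (hgi n).bdd_mul (hAm0 n).aestronglyMeasurable (ae_of_all _ (hAb n))
  have hheq : ∀ t : Fin T, h t = P[g (t + 1) | ℱ t] := fun t => by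
    rw [hh t]
    congr 1
    funext ω
    have e1 : Finset.Ioi t = Finset.univ.filter fun s : Fin T => (t : ℕ) + 1 ≤ s := by
      ext s; rw [Finset.mem_Ioi, Finset.mem_filter, Fin.lt_def]; simp
    have e2 : Finset.Iic t = Finset.univ.filter fun s : Fin T => (s : ℕ) < t + 1 := by
      ext s; rw [Finset.mem_Iic, Finset.mem_filter, Fin.le_def]; simp
    simp only [g, θ, R, D, e1, e2]
    rw [div_eq_inv_mul, one_add_one_eq_two]
  have hind : ∀ t, Measurable (fun ω => h t ω) := fun t => (hhm t).mono (hle t) le_rfl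
  have hite : ∀ t i, Measurable (fun ω => if h t ω ≤ r t i then (1 : ℝ) else 0) := fun t i =>
    Measurable.ite (measurableSet_le (hind t) measurable_const) measurable_const measurable_const
  have hWm : ∀ t, Measurable (W t) := fun t => Finset.measurable_sum _ fun i _ =>
    (((hAm0 t).mul (hpm t i)).mul (hite t i)).const_mul _
  have hWi : ∀ t, Integrable (W t) P := fun t => by
    refine integrable_finsetSum _ fun i _ => Integrable.const_mul ?_ _
    refine Integrable.of_bound (((hAm0 t).mul (hpm t i)).mul (hite t i)).aestronglyMeasurable 1
      (ae_of_all _ fun ω => ?_)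
    have h1 := mul_le_one₀ (hA t ω).2 (hp0 t i ω) (hpi1 t i ω)
    have h0 := mul_nonneg (hA t ω).1 (hp0 t i ω)
    rw [Real.norm_eq_abs, abs_le]
    split_ifs <;> constructor <;> linarith
  -- In expectation, the drop of the potential in one period is paid for by the reward collected in
  -- that period.
  have step : ∀ t : Fin T, ∫ ω, A t ω * g t ω ∂P ≤
      ∫ ω, W t ω ∂P + ∫ ω, A (t + 1) ω * g (t + 1) ω ∂P := by
    intro t
    have hDs : ∀ ω, D (t + 1) ω = ∑ i, p t i ω + D t ω := fun ω => by
      simp only [D]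
      rw [filter_lt_succ_eq_insert, Finset.sum_insert (by simp)]
    have hRs : ∀ ω, R t ω = ∑ i, r t i * p t i ω + R (t + 1) ω := fun ω => by
      simp only [R]
      rw [filter_le_eq_insert, Finset.sum_insert (by simp)]
    let c : Ω → ℝ := fun ω => A t ω * (1 - θ t ω * ∑ i, p t i ω)
    have hθP : ∀ ω, 0 ≤ θ t ω * ∑ i, p t i ω ∧ θ t ω * ∑ i, p t i ω ≤ 1 := fun ω =>
      ⟨mul_nonneg (hθ0 _ _) (hPt _ _), mul_le_one₀ (hθ1 _ _) (hPt _ _) (hp1 _ _)⟩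
    have hcb : ∀ ω, |c ω| ≤ 1 := fun ω => by
      rw [abs_le]
      have := mul_nonneg (hA t ω).1 (sub_nonneg.2 (hθP ω).2)
      have := mul_le_one₀ (hA t ω).2 (sub_nonneg.2 (hθP ω).2) (by linarith [(hθP ω).1])
      simp only [c]
      constructor <;> linarith
    have hcm : Measurable[ℱ t] c := (hAm t t (by omega)).mul
      (measurable_const.sub (((hDmt t).const_sub 2).inv.mul
        (Finset.measurable_sum _ fun i _ => hp t i)))
    have hcm0 : Measurable c := hcm.mono (hle t) le_rfl
    let B : Ω → ℝ := fun ω => ∑ i, r t i * (A t ω * θ t ω * p t i ω)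
    have hBi : Integrable B P := by
      refine integrable_finsetSum _ fun i _ => Integrable.const_mul ?_ _
      refine Integrable.of_bound
        (((hAm0 t).mul (hθm t)).mul (hpm t i)).aestronglyMeasurable 1 (ae_of_all _ fun ω => ?_)
      have h0 := mul_nonneg (hA t ω).1 (hθ0 t ω)
      have h1 := mul_le_one₀ (mul_le_one₀ (hA t ω).2 (hθ0 t ω) (hθ1 t ω)) (hp0 t i ω) (hpi1 t i ω)
      rw [Real.norm_eq_abs, abs_of_nonneg (mul_nonneg h0 (hp0 t i ω))]
      exact h1
    have hcgi : Integrable (fun ω => c ω * g (t + 1) ω) P :=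
      (hgi _).bdd_mul hcm0.aestronglyMeasurable (ae_of_all _ hcb)
    have hchi : Integrable (fun ω => c ω * h t ω) P :=
      (hhi t).bdd_mul hcm0.aestronglyMeasurable (ae_of_all _ hcb)
    have hAhi : Integrable (fun ω => A (t + 1) ω * h t ω) P :=
      (hhi t).bdd_mul (hAm0 _).aestronglyMeasurable (ae_of_all _ (hAb _))
    have e1 : ∫ ω, c ω * h t ω ∂P = ∫ ω, c ω * g (t + 1) ω ∂P := by
      rw [hheq t]; exact integral_mul_condExp (hle t) hcm (hgi _) hcb
    have e2 : ∫ ω, A (t + 1) ω * h t ω ∂P = ∫ ω, A (t + 1) ω * g (t + 1) ω ∂P := by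
      rw [hheq t]; exact integral_mul_condExp (hle t) (hAm _ t le_rfl) (hgi _) (hAb _)
    -- With P_t the proposal probability of period t, the choice of θ gives 1 - θ_t P_t = θ_t /
    -- θ_{t+1}. Thus the weight `c` exactly turns the next potential θ_{t+1} R_{t+1} into θ_t
    -- R_{t+1}.
    have e3 : ∀ ω, A t ω * g t ω = B ω + c ω * g (t + 1) ω := fun ω => by
      have h2 : (2 - D t ω) ≠ 0 := by linarith [hD1 t ω]
      have h3 : 2 - (∑ i, p t i ω + D t ω) ≠ 0 := by
        rw [← hDs]; linarith [hD1 (t + 1) ω]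
      have hB : B ω = A t ω * θ t ω * ∑ i, r t i * p t i ω := by
        simp only [B, Finset.mul_sum]
        exact Finset.sum_congr rfl fun i _ => by ring
      rw [hB]
      simp only [g, c, θ, hRs, hDs]
      field_simp
      ring
    calc ∫ ω, A t ω * g t ω ∂P = ∫ ω, B ω + c ω * g (t + 1) ω ∂P := by simp only [e3]
      _ = ∫ ω, B ω + c ω * h t ω ∂P := by
        rw [integral_add hBi hcgi, integral_add hBi hchi, e1]
      _ ≤ ∫ ω, W t ω + A (t + 1) ω * h t ω ∂P := by
        refine integral_mono (hBi.add hchi) ((hWi t).add hAhi) fun ω => ?_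
        have hAs : A (t + 1) ω = A t ω * (1 - ∑ i, p t i ω * if h t ω ≤ r t i then 1 else 0) :=
          survival_succ r p h ω t
        -- Accepting exactly when r ≥ h maximizes a(r - h) over a in [0,1], so the threshold does at
        -- least as well as accepting with probability θ.
        have key : ∀ i, A t ω * (θ t ω * p t i ω * (r t i - h t ω)) ≤
            A t ω * ((p t i ω * if h t ω ≤ r t i then 1 else 0) * (r t i - h t ω)) := fun i => by
          refine mul_le_mul_of_nonneg_left ?_ (hA t ω).1
          split_ifs with hc
          · exact mul_le_mul_of_nonneg_right (by nlinarith [hp0 t i ω, hθ1 t ω]) (by linarith)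
          · have := mul_nonneg (hθ0 t ω) (hp0 t i ω)
            nlinarith
        have := Finset.sum_le_sum fun i (_ : i ∈ Finset.univ) => key i
        have l1 : B ω + c ω * h t ω = A t ω * h t ω +
            ∑ i, A t ω * (θ t ω * p t i ω * (r t i - h t ω)) := by
          simp only [B, c, mul_sub, Finset.sum_sub_distrib, Finset.mul_sum, Finset.sum_mul, sub_mul,
            mul_one]
          rw [add_sub, add_comm, add_sub_assoc]
          congr 2 <;> exact Finset.sum_congr rfl fun i _ => by ring
        have l2 : W t ω + A (t + 1) ω * h t ω = A t ω * h t ω +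
            ∑ i, A t ω * ((p t i ω * if h t ω ≤ r t i then 1 else 0) * (r t i - h t ω)) := by
          rw [hAs]
          simp only [W, mul_sub, Finset.sum_sub_distrib, Finset.mul_sum, Finset.sum_mul, sub_mul,
            mul_one]
          rw [add_sub, add_comm, add_sub_assoc]
          congr 2 <;> exact Finset.sum_congr rfl fun i _ => by ring
        beta_reduce
        rw [l1, l2]
        linarith
      _ = ∫ ω, W t ω ∂P + ∫ ω, A (t + 1) ω * g (t + 1) ω ∂P := by
        rw [integral_add (hWi t) hAhi, e2]
  have main : ∀ n, n ≤ T → ∫ ω, A 0 ω * g 0 ω ∂P ≤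
      (∑ t ∈ Finset.univ.filter fun t : Fin T => (t : ℕ) < n, ∫ ω, W t ω ∂P) + ∫ ω, A n ω * g n ω ∂P := by
    intro n
    induction n with
    | zero => simp
    | succ n ih =>
      intro hn
      have := filter_lt_succ_eq_insert (⟨n, hn⟩ : Fin T)
      simp only at this
      rw [this, Finset.sum_insert (by simp)]
      have := step ⟨n, hn⟩
      simp only at this
      linarith [ih (by omega)]
  have hT := main T le_rfl
  have hlast : ∀ ω, g T ω = 0 := fun ω => by
    simp only [g, R]
    rw [Finset.filter_false_of_mem (fun s _ => by omega), Finset.sum_empty, mul_zero]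
  have hfirst : ∀ ω, A 0 ω * g 0 ω = 1 / 2 * ∑ t, ∑ i, r t i * p t i ω := fun ω => by
    simp [A, survival, g, θ, D, R]
  simp only [hlast, hfirst, mul_zero, integral_zero, add_zero, integral_const_mul] at hT
  rw [Finset.filter_true_of_mem (fun s _ => s.2)] at hT
  rw [integral_finsetSum _ fun t _ => hWi t]
  exact hT

end Prophet

end

/-! ### σ-algebras generated by families of seeds -/

noncomputable section

section SeedAlgebra

variable {Ω κ : Type*}

/-- The σ-algebra generated by the real random variables `f k`, `k ∈ S`. -/
abbrev seedAlg (f : κ → Ω → ℝ) (S : Set κ) : MeasurableSpace Ω :=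
  ⨆ k ∈ S, MeasurableSpace.comap (f k) inferInstance

lemma seedAlg_mono (f : κ → Ω → ℝ) {S S' : Set κ} (h : S ⊆ S') : seedAlg f S ≤ seedAlg f S' :=
  biSup_mono h

lemma measurable_seedAlg (f : κ → Ω → ℝ) {S : Set κ} {k : κ} (hk : k ∈ S) :
    Measurable[seedAlg f S] (f k) :=
  Measurable.of_comap_le (le_iSup₂ (f := fun k (_ : k ∈ S) =>
    MeasurableSpace.comap (f k) inferInstance) k hk)

lemma seedAlg_le [m0 : MeasurableSpace Ω] {f : κ → Ω → ℝ} (hf : ∀ k, Measurable (f k))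
    (S : Set κ) : seedAlg f S ≤ m0 :=
  iSup₂_le fun k _ => (hf k).comap_le

lemma indep_seedAlg [MeasurableSpace Ω] {P : Measure Ω} {f : κ → Ω → ℝ}
    (hf : ∀ k, Measurable (f k)) (hind : iIndepFun f P) {S : Set κ} {k : κ} (hk : k ∉ S) :
    Indep (MeasurableSpace.comap (f k) inferInstance) (seedAlg f S) P := by
  have := indep_iSup_of_disjoint (fun k => (hf k).comap_le) hind
    (Set.disjoint_singleton_left.2 hk)
  simpa [seedAlg] using this

end SeedAlgebra

namespace Market

variable {I J T : ℕ} (K : Market I J T)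

/-! ### Pathwise bounds on the routing probabilities -/

section Routing

variable {K} {x : Fin I → Fin J → Fin T → Fin T → ℝ} (hx : AssignmentFeasible K.lam K.mu x)
  {m : Fin J → Fin T → ℝ} (hm0 : ∀ j s, 0 ≤ m j s)

include hx in
lemma route_nonneg (i j t s) : 0 ≤ x i j t s / K.mu j s :=
  div_nonneg (hx.nonneg i j t s) (K.mu_pos j s).le

include hx hm0

lemma routingMass_nonneg (i t) : 0 ≤ K.routingMass x m i t :=
  Finset.sum_nonneg fun j _ => Finset.sum_nonneg fun s _ =>
    mul_nonneg (hm0 j s) (route_nonneg hx i j t s)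

lemma routingRatio_nonneg (i t) :
    0 ≤ min (K.lam i t) (K.routingMass x m i t) / K.routingMass x m i t :=
  div_nonneg (le_min (K.lam_pos i t).le (routingMass_nonneg hx hm0 i t))
    (routingMass_nonneg hx hm0 i t)

lemma routingRatio_le_one (i t) :
    min (K.lam i t) (K.routingMass x m i t) / K.routingMass x m i t ≤ 1 :=
  div_le_one_of_le₀ (min_le_right _ _) (routingMass_nonneg hx hm0 i t)

lemma prob_nonneg (i j t s) : 0 ≤ K.prob x m i j t s :=
  mul_nonneg (routingRatio_nonneg hx hm0 i t) (mul_nonneg (hm0 j s) (route_nonneg hx i j t s))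

lemma prob_le (i j t s) : K.prob x m i j t s ≤ m j s * (x i j t s / K.mu j s) :=
  mul_le_of_le_one_left (mul_nonneg (hm0 j s) (route_nonneg hx i j t s))
    (routingRatio_le_one hx hm0 i t)

/-- The supply constraint gives this along each path, not merely in expectation, which is what the
prophet inequality needs. -/
lemma sum_prob_le_one (hm1 : ∀ j s, m j s ≤ 1) (j s) : ∑ t, ∑ i, K.prob x m i j t s ≤ 1 := by
  calc ∑ t, ∑ i, K.prob x m i j t s ≤ ∑ t, ∑ i, x i j t s / K.mu j s :=
        Finset.sum_le_sum fun t _ => Finset.sum_le_sum fun i _ => (prob_le hx hm0 i j t s).trans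
          (mul_le_of_le_one_left (route_nonneg hx i j t s) (hm1 j s))
    _ = (∑ i, ∑ t, x i j t s) / K.mu j s := by
        rw [Finset.sum_comm]; simp only [Finset.sum_div]
    _ ≤ 1 := div_le_one_of_le₀ (hx.supply j s) (K.mu_pos j s).le

-- The cap min(λ,Q)/Q scales the total mass Q down to at most λ, so the picking probabilities form a
-- subprobability distribution.
omit hm0 in
lemma sum_prob_div_le_one (i t) :
    ∑ c : Fin J ×ₗ Fin T, K.prob x m i (ofLex c).1 t (ofLex c).2 / K.lam i t ≤ 1 := by
  rw [← Finset.sum_div]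
  refine div_le_one_of_le₀ ?_ (K.lam_pos i t).le
  have e : ∑ c : Fin J ×ₗ Fin T, K.prob x m i (ofLex c).1 t (ofLex c).2 =
      ∑ j, ∑ s, K.prob x m i j t s := by
    rw [← Fintype.sum_prod_type' (f := fun j s => K.prob x m i j t s)]
    exact Fintype.sum_equiv ofLex _ _ fun _ => rfl
  -- By causality the terms with `s > t` vanish, so the sum over all periods is the routing mass.
  have e2 : ∑ j, ∑ s, m j s * (x i j t s / K.mu j s) = K.routingMass x m i t := by
    refine Finset.sum_congr rfl fun j _ => (Finset.sum_subset (Finset.subset_univ _) ?_).symm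
    intro s _ hs
    rw [hx.causal i j t s (by simpa using hs)]
    simp
  rw [e]
  simp only [prob, ← Finset.mul_sum]
  rw [e2]
  by_cases h0 : K.routingMass x m i t = 0
  · rw [h0, mul_zero]; exact (K.lam_pos i t).le
  · rw [div_mul_cancel₀ _ h0]; exact min_le_left _ _

/-- Replacing λ/Q by its tangent at Q = 2λ makes the bound linear in Q, so only the mean of Q given
an arrival is needed. After multiplication by Q it reduces to (2λ - Q)² ≥ 0 and Q ≥ 0. -/
lemma le_prob (i j t s) :
    m j s * (x i j t s / K.mu j s) * (1 - K.routingMass x m i t / (4 * K.lam i t)) ≤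
      K.prob x m i j t s := by
  have hc := mul_nonneg (hm0 j s) (route_nonneg hx i j t s)
  have hQ := routingMass_nonneg hx hm0 i t
  have hl := K.lam_pos i t
  rw [prob, mul_comm]
  rcases hQ.eq_or_lt with h0 | h0
  -- If Q = 0 the ratio is 0 by convention, but then every summand of Q vanishes, and so does the
  -- term being routed.
  · suffices m j s * (x i j t s / K.mu j s) = 0 by simp [this]
    rcases lt_or_ge t s with hts | hts
    · simp [hx.causal i j t s hts]
    · have h1 := (Finset.sum_eq_zero_iff_of_nonneg fun j _ => Finset.sum_nonneg fun s _ =>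
        mul_nonneg (hm0 j s) (route_nonneg hx i j t s)).1 h0.symm j (Finset.mem_univ j)
      exact (Finset.sum_eq_zero_iff_of_nonneg fun s _ =>
        mul_nonneg (hm0 j s) (route_nonneg hx i j t s)).1 h1 s (Finset.mem_Iic.2 hts)
  · refine mul_le_mul_of_nonneg_right ?_ hc
    rw [le_div_iff₀ h0, le_min_iff]
    have e : (1 - K.routingMass x m i t / (4 * K.lam i t)) * K.routingMass x m i t =
        K.lam i t - (2 * K.lam i t - K.routingMass x m i t) ^ 2 / (4 * K.lam i t) := by
      field_simp; ring
    constructor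
    · rw [e]
      have : 0 ≤ (2 * K.lam i t - K.routingMass x m i t) ^ 2 / (4 * K.lam i t) := by positivity
      linarith
    · have : 0 ≤ K.routingMass x m i t / (4 * K.lam i t) := by positivity
      nlinarith

end Routing

/-! ### Measurability of the arrivals and of the information σ-algebras -/

section Arrivals

variable {Ω : Type*} {K} {u v w : Fin T → Ω → ℝ}

lemma supplyArr_nonneg (ω : Ω) (j s) : 0 ≤ K.supplyArr v ω j s := drawIndicator_nonneg _ _ _

lemma supplyArr_le_one (ω : Ω) (j s) : K.supplyArr v ω j s ≤ 1 := drawIndicator_le_one _ _ _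

lemma measurable_supplyArr {m : MeasurableSpace Ω} {s : Fin T} (hv : Measurable[m] (v s))
    (j : Fin J) : Measurable[m] fun ω => K.supplyArr v ω j s :=
  measurable_drawIndicator (q := fun _ k => K.mu k s) (fun _ => measurable_const) hv j

lemma measurable_demandArr {m : MeasurableSpace Ω} {t : Fin T} (hu : Measurable[m] (u t))
    (i : Fin I) : Measurable[m] fun ω => K.demandArr u ω i t :=
  measurable_drawIndicator (q := fun _ k => K.lam k t) (fun _ => measurable_const) hu i

/-- Causality kills the terms with `s > t`, so only supply up to period `t` matters. -/
lemma measurable_prob {x : Fin I → Fin J → Fin T → Fin T → ℝ}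
    (hx : AssignmentFeasible K.lam K.mu x) {m : MeasurableSpace Ω} {t : Fin T}
    (hM : ∀ j, ∀ s ≤ t, Measurable[m] fun ω => K.supplyArr v ω j s) (i : Fin I) (j : Fin J)
    (s : Fin T) : Measurable[m] fun ω => K.prob x (K.supplyArr v ω) i j t s := by
  rcases lt_or_ge t s with hts | hts
  · simp [prob, hx.causal i j t s hts]
  · have hQ : Measurable[m] fun ω => K.routingMass x (K.supplyArr v ω) i t :=
      Finset.measurable_sum _ fun j' _ => Finset.measurable_sum _ fun s' hs' =>
        (hM j' s' (Finset.mem_Iic.1 hs')).mul_const _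
    exact ((measurable_const.min hQ).div hQ).mul ((hM j s hts).mul_const _)

lemma measurable_supplyArr_infoUpTo {s t : Fin T} (hst : s ≤ t) (j : Fin J) :
    Measurable[K.infoUpTo v t] fun ω => K.supplyArr v ω j s := by
  have h : Measurable fun f : Fin J → Finset.Iic t → ℝ => f j ⟨s, Finset.mem_Iic.2 hst⟩ := by
    fun_prop
  exact h.comp (comap_measurable _)

lemma infoUpTo_le {m : MeasurableSpace Ω} {t : Fin T}
    (hM : ∀ j, ∀ s ≤ t, Measurable[m] fun ω => K.supplyArr v ω j s) : K.infoUpTo v t ≤ m := by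
  refine Measurable.comap_le ?_
  exact measurable_pi_iff.2 fun j => measurable_pi_iff.2 fun s => hM j s (Finset.mem_Iic.1 s.2)

lemma infoUpTo_mono : Monotone (K.infoUpTo v) := fun _ _ h =>
  infoUpTo_le fun j _ hs => measurable_supplyArr_infoUpTo (hs.trans h) j

end Arrivals

end Market

end

/-! ### From survival probabilities to the actual online algorithm -/

noncomputable section

namespace Market

variable {I J T : ℕ} {K : Market I J T}

/-- Indices, in the family of all seeds `(u, v, w)`, of every supply seed and of the demand and
selection seeds of the first `n` periods. -/
def pastSeeds (T n : ℕ) : Set (Fin T ⊕ Fin T ⊕ Fin T) :=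
  {k | Sum.elim (fun t : Fin T => (t : ℕ) < n)
    (Sum.elim (fun _ => True) fun t : Fin T => (t : ℕ) < n) k}

lemma pastSeeds_mono {n n' : ℕ} (h : n ≤ n') : pastSeeds T n ⊆ pastSeeds T n' := by
  rintro (t | t | t) ht
  · exact lt_of_lt_of_le ht h
  · exact True.intro
  · exact lt_of_lt_of_le ht h

section Online

variable {Ω : Type*} [MeasurableSpace Ω] {P : Measure Ω} {x : Fin I → Fin J → Fin T → Fin T → ℝ}
  {u v w : Fin T → Ω → ℝ}

omit [MeasurableSpace Ω] in
lemma measurable_supplyArr_seedAlg (n : ℕ) (j : Fin J) (s : Fin T) :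
    Measurable[seedAlg (Sum.elim u (Sum.elim v w)) (pastSeeds T n)]
      fun ω => K.supplyArr v ω j s :=
  measurable_supplyArr
    (measurable_seedAlg (Sum.elim u (Sum.elim v w)) (S := pastSeeds T n)
      (k := Sum.inr (Sum.inl s)) True.intro) j

lemma measurable_threshold_infoUpTo (j : Fin J) (s t : Fin T) :
    Measurable[K.infoUpTo v t] (K.threshold P x v j s t) :=
  stronglyMeasurable_condExp.measurable

lemma measurable_threshold_seedAlg (n : ℕ) (j : Fin J) (s t : Fin T) :
    Measurable[seedAlg (Sum.elim u (Sum.elim v w)) (pastSeeds T n)]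
      (K.threshold P x v j s t) :=
  (measurable_threshold_infoUpTo j s t).mono
    (infoUpTo_le fun j' s' _ => measurable_supplyArr_seedAlg n j' s') le_rfl

omit [MeasurableSpace Ω] in
omit [MeasurableSpace Ω] in
open Classical in
lemma ite_picked_eq (ω : Ω) (i : Fin I) (j : Fin J) (t s : Fin T) :
    (if K.Picked x u v w ω i j t s then (1 : ℝ) else 0) =
      drawIndicator (fun c : Fin J ×ₗ Fin T =>
        K.prob x (K.supplyArr v ω) i (ofLex c).1 t (ofLex c).2 / K.lam i t)
        (toLex (j, s)) (w t ω) * drawIndicator (fun k => K.lam k t) i (u t ω) := by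
  rw [Picked, demandArr]
  rcases drawIndicator_eq_zero_or_one (fun k => K.lam k t) i (u t ω) with h1 | h1 <;>
  rcases drawIndicator_eq_zero_or_one (fun c : Fin J ×ₗ Fin T =>
        K.prob x (K.supplyArr v ω) i (ofLex c).1 t (ofLex c).2 / K.lam i t)
        (toLex (j, s)) (w t ω) with h2 | h2 <;> simp [h1, h2]

variable (hx : AssignmentFeasible K.lam K.mu x)

section Measurability

include hx

omit [MeasurableSpace Ω] in
omit [MeasurableSpace Ω] in
lemma measurable_selection {m : MeasurableSpace Ω} {t : Fin T}
    (hM : ∀ j s, Measurable[m] fun ω => K.supplyArr v ω j s) (hw : Measurable[m] (w t))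
    (i : Fin I) (c : Fin J ×ₗ Fin T) :
    Measurable[m] fun ω => drawIndicator (fun c : Fin J ×ₗ Fin T =>
      K.prob x (K.supplyArr v ω) i (ofLex c).1 t (ofLex c).2 / K.lam i t) c (w t ω) :=
  measurable_drawIndicator (q := fun ω (c : Fin J ×ₗ Fin T) =>
      K.prob x (K.supplyArr v ω) i (ofLex c).1 t (ofLex c).2 / K.lam i t)
    (fun _ => (measurable_prob hx (fun j s _ => hM j s) i _ _).div_const _) hw c

omit [MeasurableSpace Ω] in
lemma measurableSet_picked {n : ℕ} {t : Fin T} (ht : (t : ℕ) < n) (i : Fin I) (j : Fin J)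
    (s : Fin T) :
    MeasurableSet[seedAlg (Sum.elim u (Sum.elim v w)) (pastSeeds T n)]
      {ω | K.Picked x u v w ω i j t s} := by
  refine MeasurableSet.inter ?_ ?_
  · exact measurable_demandArr (measurable_seedAlg (Sum.elim u (Sum.elim v w)) (k := Sum.inl t) ht)
      i (measurableSet_singleton 1)
  · exact measurable_selection hx (fun j s => measurable_supplyArr_seedAlg n j s)
      (measurable_seedAlg (Sum.elim u (Sum.elim v w)) (k := Sum.inr (Sum.inr t)) ht) i _
      (measurableSet_singleton 1)

lemma measurableSet_available (j : Fin J) (s : Fin T) (n : ℕ) :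
    MeasurableSet[seedAlg (Sum.elim u (Sum.elim v w)) (pastSeeds T n)]
      {ω | K.Available P x u v w ω j s n} := by
  induction n with
  | zero => simp [Available]
  | succ n ih =>
    have ih' := seedAlg_mono (Sum.elim u (Sum.elim v w))
      (pastSeeds_mono (T := T) n.le_succ) _ ih
    by_cases hn : n < T
    · have e : {ω | K.Available P x u v w ω j s (n + 1)} = {ω | K.Available P x u v w ω j s n} ∩
          ⋂ i, ({ω | K.Picked x u v w ω i j ⟨n, hn⟩ s} ∩ ({ω | K.Available P x u v w ω j s n} ∩
            {ω | K.threshold P x v j s ⟨n, hn⟩ ω ≤ K.r i j ⟨n, hn⟩ s}))ᶜ := by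
        ext ω
        simp [Available, hn]
      rw [e]
      refine ih'.inter (MeasurableSet.iInter fun i => MeasurableSet.compl ?_)
      exact (measurableSet_picked hx (by simp) i j s).inter (ih'.inter
        (measurableSet_le (measurable_threshold_seedAlg _ j s _) measurable_const))
    · have e : {ω | K.Available P x u v w ω j s (n + 1)} = {ω | K.Available P x u v w ω j s n} := by
        ext ω
        simp [Available, hn]
      rw [e]
      exact ih'

end Measurability

variable [IsProbabilityMeasure P]
  (hu : ∀ t, Measurable (u t)) (hv : ∀ t, Measurable (v t)) (hw : ∀ t, Measurable (w t))
  (hu_unif : ∀ t, P.map (u t) = volume.restrict (Set.Icc 0 1))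
  (hw_unif : ∀ t, P.map (w t) = volume.restrict (Set.Icc 0 1))
  (hindep : iIndepFun (Sum.elim u (Sum.elim v w)) P)

include hu hv hw in
lemma measurable_seeds :
    ∀ k, Measurable (Sum.elim u (Sum.elim v w) k) := by
  rintro (t | t | t)
  exacts [hu t, hv t, hw t]

include hx hu hv hw hu_unif hw_unif hindep

-- The seeds u_t and w_t are fresh relative to `Z`. Integrating out u_t, then w_t, gives the factors
-- λ and p/λ.
open Classical in
lemma integral_mul_picked {t : Fin T} {Z : Ω → ℝ} {C : ℝ} (hC : ∀ ω, |Z ω| ≤ C)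
    (hZ : Measurable[seedAlg (Sum.elim u (Sum.elim v w)) (pastSeeds T t)] Z) (i : Fin I) (j : Fin J)
    (s : Fin T) :
    ∫ ω, Z ω * (if K.Picked x u v w ω i j t s then (1 : ℝ) else 0) ∂P =
      ∫ ω, Z ω * K.prob x (K.supplyArr v ω) i j t s ∂P := by
  have hf := measurable_seeds hu hv hw
  let f := Sum.elim u (Sum.elim v w)
  -- The seed u_t is integrated out first, so its weight may still involve w_t.
  let S : Set (Fin T ⊕ Fin T ⊕ Fin T) := insert (Sum.inr (Sum.inr t)) (pastSeeds T t)
  have hu' : (Sum.inl t : Fin T ⊕ Fin T ⊕ Fin T) ∉ S := by simp [S, pastSeeds]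
  have hw' : (Sum.inr (Sum.inr t) : Fin T ⊕ Fin T ⊕ Fin T) ∉ pastSeeds T t := by simp [pastSeeds]
  let q : Ω → Fin J ×ₗ Fin T → ℝ := fun ω c =>
    K.prob x (K.supplyArr v ω) i (ofLex c).1 t (ofLex c).2 / K.lam i t
  have hsub : seedAlg f (pastSeeds T t) ≤ seedAlg f S := seedAlg_mono f (Set.subset_insert _ _)
  have hsel : Measurable[seedAlg f S] fun ω => drawIndicator (q ω) (toLex (j, s)) (w t ω) :=
    measurable_selection hx
      (fun j s => (measurable_supplyArr_seedAlg t j s).mono hsub le_rfl)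
      (measurable_seedAlg f (k := Sum.inr (Sum.inr t)) (Set.mem_insert _ _)) i _
  have h1 := integral_mul_drawIndicator (seedAlg_le hf S) (hu t) (hu_unif t)
    (indep_seedAlg hf hindep hu') (q := fun _ k => K.lam k t) (fun _ => measurable_const)
    (fun _ k => (K.lam_pos k t).le) (fun _ => K.sum_lam_le_one t)
    (Z := fun ω => Z ω * drawIndicator (q ω) (toLex (j, s)) (w t ω))
    ((hZ.mono hsub le_rfl).mul hsel) (C := C)
    (fun ω => by
      rw [abs_mul, abs_of_nonneg (drawIndicator_nonneg _ _ _)]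
      exact (mul_le_of_le_one_right (abs_nonneg _) (drawIndicator_le_one _ _ _)).trans (hC ω)) i
  have h2 := integral_mul_drawIndicator (seedAlg_le hf (pastSeeds T t)) (hw t) (hw_unif t)
    (indep_seedAlg hf hindep hw') (q := q)
    (fun c => (measurable_prob hx (fun j s _ => measurable_supplyArr_seedAlg t j s) i _ _).div_const
      _)
    (fun ω c => div_nonneg (prob_nonneg hx (supplyArr_nonneg ω) i _ t _) (K.lam_pos i t).le)
    (fun ω => sum_prob_div_le_one hx i t) hZ hC (toLex (j, s))
  calc ∫ ω, Z ω * (if K.Picked x u v w ω i j t s then (1 : ℝ) else 0) ∂P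
      = ∫ ω, Z ω * drawIndicator (q ω) (toLex (j, s)) (w t ω) *
          drawIndicator (fun k => K.lam k t) i (u t ω) ∂P := by
        simp only [ite_picked_eq, mul_assoc, q]
    _ = (∫ ω, Z ω * q ω (toLex (j, s)) ∂P) * K.lam i t := by
        rw [h1, integral_mul_const, h2]
    _ = ∫ ω, Z ω * K.prob x (K.supplyArr v ω) i j t s ∂P := by
        rw [← integral_mul_const]
        refine integral_congr_ae (ae_of_all _ fun ω => ?_)
        have := (K.lam_pos i t).ne'
        simp only [q, ofLex_toLex]
        field_simp

-- Given the whole supply path, the unit is available with probability at least `survival`; the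
-- arbitrary weight `Z` expresses this conditioning. A union bound over the candidates suffices, so
-- no disjointness of the picks is needed.
open Classical in
lemma integral_mul_survival_le (j : Fin J) (s : Fin T) (n : ℕ) {Z : Ω → ℝ} {C : ℝ}
    (hZ0 : ∀ ω, 0 ≤ Z ω) (hC : ∀ ω, Z ω ≤ C)
    (hZ : Measurable[seedAlg (Sum.elim u (Sum.elim v w)) (pastSeeds T 0)] Z) :
    ∫ ω, Z ω * survival (fun t i => K.r i j t s)
        (fun t i ω => K.prob x (K.supplyArr v ω) i j t s) (K.threshold P x v j s) ω n ∂P ≤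
      ∫ ω, Z ω * (if K.Available P x u v w ω j s n then 1 else 0) ∂P := by
  have hf := measurable_seeds hu hv hw
  induction n generalizing Z with
  | zero => simp [survival, Available]
  | succ n ih =>
    by_cases hn : n < T
    swap
    · simpa [survival, Available, hn] using ih hZ0 hC hZ
    let t : Fin T := ⟨n, hn⟩
    let p : Fin I → Ω → ℝ := fun i ω => K.prob x (K.supplyArr v ω) i j t s
    let a : Fin I → Ω → ℝ := fun i ω => if K.threshold P x v j s t ω ≤ K.r i j t s then 1 else 0
    let B : ℕ → Ω → ℝ := fun n ω => if K.Available P x u v w ω j s n then 1 else 0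
    let X : Fin I → Ω → ℝ := fun i ω => if K.Picked x u v w ω i j t s then 1 else 0
    have hFle := seedAlg_le hf (pastSeeds T n)
    have hp0 : ∀ i ω, 0 ≤ p i ω := fun i ω => prob_nonneg hx (supplyArr_nonneg ω) i j t s
    have hsum : ∀ ω, ∑ i, p i ω ≤ 1 := fun ω =>
      (Finset.single_le_sum (f := fun t => ∑ i, K.prob x (K.supplyArr v ω) i j t s)
        (fun t _ => Finset.sum_nonneg fun i _ => prob_nonneg hx (supplyArr_nonneg ω) i j t s)
        (Finset.mem_univ t)).trans
      (sum_prob_le_one hx (supplyArr_nonneg ω) (supplyArr_le_one ω) j s)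
    have hp1 : ∀ i ω, p i ω ≤ 1 := fun i ω => (Finset.single_le_sum (f := fun i => p i ω)
      (fun i _ => hp0 i ω) (Finset.mem_univ i)).trans (hsum ω)
    have ha0 : ∀ i ω, 0 ≤ a i ω := fun i ω => by simp only [a]; split_ifs <;> simp
    have ha1 : ∀ i ω, a i ω ≤ 1 := fun i ω => by simp only [a]; split_ifs <;> simp
    have hB0 : ∀ n ω, 0 ≤ B n ω := fun n ω => by simp only [B]; split_ifs <;> simp
    have hB1 : ∀ n ω, B n ω ≤ 1 := fun n ω => by simp only [B]; split_ifs <;> simp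
    have hX0 : ∀ i ω, 0 ≤ X i ω := fun i ω => by simp only [X]; split_ifs <;> simp
    have hX1 : ∀ i ω, X i ω ≤ 1 := fun i ω => by simp only [X]; split_ifs <;> simp
    have hpm : ∀ k i, Measurable[seedAlg (Sum.elim u (Sum.elim v w)) (pastSeeds T k)] (p i) :=
      fun k i => measurable_prob hx (fun j s _ => measurable_supplyArr_seedAlg k j s) i j s
    have ham : ∀ k i, Measurable[seedAlg (Sum.elim u (Sum.elim v w)) (pastSeeds T k)] (a i) :=
      fun k i => Measurable.ite
        (measurableSet_le (measurable_threshold_seedAlg k j s t) measurable_const)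
        measurable_const measurable_const
    have hBm : ∀ k, Measurable[seedAlg (Sum.elim u (Sum.elim v w)) (pastSeeds T k)] (B k) :=
      fun k => Measurable.ite (measurableSet_available hx j s k) measurable_const measurable_const
    have hXm : ∀ i, Measurable (X i) := fun i => Measurable.ite
      (seedAlg_le hf _ _ (measurableSet_picked hx (Nat.lt_succ_self t) i j s))
      measurable_const measurable_const
    have hZn : Measurable[seedAlg (Sum.elim u (Sum.elim v w)) (pastSeeds T n)] Z := hZ.mono (seedAlg_mono _ (pastSeeds_mono n.zero_le)) le_rfl
    have hpa0 : ∀ ω, 0 ≤ ∑ i, p i ω * a i ω := fun ω =>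
      Finset.sum_nonneg fun i _ => mul_nonneg (hp0 i ω) (ha0 i ω)
    have hpa1 : ∀ ω, ∑ i, p i ω * a i ω ≤ 1 := fun ω =>
      (Finset.sum_le_sum fun i _ => mul_le_of_le_one_right (hp0 i ω) (ha1 i ω)).trans (hsum ω)
    have hZB : Measurable[seedAlg (Sum.elim u (Sum.elim v w)) (pastSeeds T n)] fun ω => Z ω * B n ω := hZn.mul (hBm n)
    have hZBC : ∀ n ω, |Z ω * B n ω| ≤ C := fun n ω => by
      rw [abs_of_nonneg (mul_nonneg (hZ0 ω) (hB0 n ω))]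
      exact (mul_le_of_le_one_right (hZ0 ω) (hB1 n ω)).trans (hC ω)
    have hZBa : ∀ i, Measurable[seedAlg (Sum.elim u (Sum.elim v w)) (pastSeeds T n)] fun ω => Z ω * B n ω * a i ω := fun i => hZB.mul (ham n i)
    have hZBaC : ∀ i ω, |Z ω * B n ω * a i ω| ≤ C := fun i ω => by
      rw [abs_mul, abs_of_nonneg (ha0 i ω)]
      exact (mul_le_of_le_one_right (abs_nonneg _) (ha1 i ω)).trans (hZBC n ω)
    have hZBi : Integrable (fun ω => Z ω * B n ω) P := Integrable.of_bound
      (hZB.mono hFle le_rfl).aestronglyMeasurable C (ae_of_all _ (hZBC n))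
    have hZBai : ∀ i, Integrable (fun ω => Z ω * B n ω * a i ω) P := fun i => Integrable.of_bound
      ((hZBa i).mono hFle le_rfl).aestronglyMeasurable C (ae_of_all _ (hZBaC i))
    have hip : ∀ i, Integrable (fun ω => Z ω * B n ω * a i ω * p i ω) P := fun i =>
      (hZBai i).mul_bdd (c := 1) ((hpm n i).mono hFle le_rfl).aestronglyMeasurable
        (ae_of_all _ fun ω => by rw [Real.norm_eq_abs, abs_of_nonneg (hp0 i ω)]; exact hp1 i ω)
    have hiX : ∀ i, Integrable (fun ω => Z ω * B n ω * a i ω * X i ω) P := fun i =>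
      (hZBai i).mul_bdd (c := 1) (hXm i).aestronglyMeasurable
        (ae_of_all _ fun ω => by rw [Real.norm_eq_abs, abs_of_nonneg (hX0 i ω)]; exact hX1 i ω)
    calc ∫ ω, Z ω * survival (fun t i => K.r i j t s)
          (fun t i ω => K.prob x (K.supplyArr v ω) i j t s) (K.threshold P x v j s) ω (n + 1) ∂P
        = ∫ ω, (Z ω * (1 - ∑ i, p i ω * a i ω)) * survival (fun t i => K.r i j t s)
          (fun t i ω => K.prob x (K.supplyArr v ω) i j t s) (K.threshold P x v j s) ω n ∂P := by
          refine integral_congr_ae (ae_of_all _ fun ω => ?_)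
          have := survival_succ (fun t i => K.r i j t s)
            (fun t i ω => K.prob x (K.supplyArr v ω) i j t s) (K.threshold P x v j s) ω t
          simp only [t] at this
          simp only [this, p, a, t]
          ring
      -- The factor for period `n` depends on supply only, so it can join the weight in the
      -- induction hypothesis.
      _ ≤ ∫ ω, (Z ω * (1 - ∑ i, p i ω * a i ω)) * B n ω ∂P :=
          ih (fun ω => mul_nonneg (hZ0 ω) (sub_nonneg.2 (hpa1 ω)))
            (fun ω => (mul_le_of_le_one_right (hZ0 ω) (by linarith [hpa0 ω])).trans (hC ω))
            (hZ.mul (measurable_const.sub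
              (Finset.measurable_sum _ fun i _ => (hpm 0 i).mul (ham 0 i))))
      _ = ∫ ω, Z ω * B n ω - ∑ i, Z ω * B n ω * a i ω * p i ω ∂P := by
          refine integral_congr_ae (ae_of_all _ fun ω => ?_)
          simp only [mul_sub, sub_mul, mul_one, Finset.mul_sum, Finset.sum_mul]
          congr 1
          exact Finset.sum_congr rfl fun i _ => by ring
      -- Availability before period `n` and the threshold test do not involve the seeds u, w of
      -- period `n`, so p may be exchanged for the pick indicator.
      _ = ∫ ω, Z ω * B n ω - ∑ i, Z ω * B n ω * a i ω * X i ω ∂P := by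
          rw [integral_sub hZBi (integrable_finsetSum _ fun i _ => hip i),
            integral_sub hZBi (integrable_finsetSum _ fun i _ => hiX i),
            integral_finsetSum _ fun i _ => hip i, integral_finsetSum _ fun i _ => hiX i]
          congr 1
          exact Finset.sum_congr rfl fun i _ => (integral_mul_picked hx hu hv hw hu_unif hw_unif
            hindep (t := t) (hZBaC i) (hZBa i) i j s).symm
      _ ≤ ∫ ω, Z ω * B (n + 1) ω ∂P := by
          refine integral_mono (hZBi.sub (integrable_finsetSum _ fun i _ => hiX i))
            (Integrable.of_bound ((hZ.mono (seedAlg_mono _ (pastSeeds_mono (n + 1).zero_le))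
              le_rfl).mul (hBm (n + 1)) |>.mono (seedAlg_le hf _) le_rfl).aestronglyMeasurable C
              (ae_of_all _ (hZBC (n + 1)))) fun ω => ?_
          have e : Z ω * B n ω - ∑ i, Z ω * B n ω * a i ω * X i ω =
              Z ω * (B n ω * (1 - ∑ i, a i ω * X i ω)) := by
            simp only [mul_sub, mul_one, Finset.mul_sum]
            congr 1
            exact Finset.sum_congr rfl fun i _ => by ring
          have hs0 : 0 ≤ ∑ i, a i ω * X i ω :=
            Finset.sum_nonneg fun i _ => mul_nonneg (ha0 i ω) (hX0 i ω)
          beta_reduce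
          rw [e]
          refine mul_le_mul_of_nonneg_left ?_ (hZ0 ω)
          by_cases hA : K.Available P x u v w ω j s n
          · have hBn : B n ω = 1 := if_pos hA
            rw [hBn, one_mul]
            by_cases hA' : K.Available P x u v w ω j s (n + 1)
            · have : B (n + 1) ω = 1 := if_pos hA'
              linarith
            · have h0 : B (n + 1) ω = 0 := if_neg hA'
              obtain ⟨i, hi1, hi2⟩ : ∃ i, K.Picked x u v w ω i j t s ∧
                  K.threshold P x v j s t ω ≤ K.r i j t s := by
                by_contra hcon
                push Not at hcon
                exact hA' ⟨hA, fun _ i hi => (hcon i hi.1).not_ge hi.2.2⟩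
              have := Finset.single_le_sum (f := fun i => a i ω * X i ω)
                (fun i _ => mul_nonneg (ha0 i ω) (hX0 i ω)) (Finset.mem_univ i)
              have h1 : a i ω * X i ω = 1 := by simp [a, X, hi1, hi2]
              simp only [h1] at this
              linarith
          · have hBn : B n ω = 0 := if_neg hA
            rw [hBn, zero_mul]
            exact hB0 _ ω

omit hu_unif hw_unif hindep in
omit hu_unif hw_unif hindep in
open Classical in
lemma integrable_matched (i : Fin I) (j : Fin J) (t s : Fin T) :
    Integrable (fun ω => if K.Matched P x u v w ω i j t s then K.r i j t s else 0) P := by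
  have hf := measurable_seeds hu hv hw
  refine Integrable.of_bound (Measurable.ite ?_ measurable_const
    measurable_const).aestronglyMeasurable (K.r i j t s) (ae_of_all _ fun ω => ?_)
  · exact (seedAlg_le hf _ _ (measurableSet_picked hx (Nat.lt_succ_self t) i j s)).inter
      ((seedAlg_le hf _ _ (measurableSet_available hx j s t)).inter
      (seedAlg_le hf _ _ (measurableSet_le (measurable_threshold_seedAlg 0 j s t)
        measurable_const)))
  · rw [Real.norm_eq_abs]
    split_ifs
    · exact (abs_of_nonneg (K.r_nonneg i j t s)).le
    · simpa using K.r_nonneg i j t s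

open Classical in
/-- The reward earned from a single supply unit is at least half of the expected reward of the
demand routed to it. -/
lemma half_routed_le_integral_matched (j : Fin J) (s : Fin T) :
    1 / 2 * ∑ t, ∑ i, K.r i j t s * ∫ ω, K.prob x (K.supplyArr v ω) i j t s ∂P ≤
      ∑ t, ∑ i, ∫ ω, (if K.Matched P x u v w ω i j t s then K.r i j t s else 0) ∂P := by
  have hf := measurable_seeds hu hv hw
  have hM : ∀ j s, Measurable fun ω => K.supplyArr v ω j s := fun j s =>
    measurable_supplyArr (hv s) j
  let p : Fin T → Fin I → Ω → ℝ := fun t i ω => K.prob x (K.supplyArr v ω) i j t s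
  let h := K.threshold P x v j s
  let A : ℕ → Ω → ℝ := fun n ω => survival (fun t i => K.r i j t s) p h ω n
  have hp0 : ∀ t i ω, 0 ≤ p t i ω := fun t i ω => prob_nonneg hx (supplyArr_nonneg ω) i j t s
  have hsum : ∀ ω, ∑ t, ∑ i, p t i ω ≤ 1 := fun ω =>
    sum_prob_le_one hx (supplyArr_nonneg ω) (supplyArr_le_one ω) j s
  have hPt : ∀ t ω, ∑ i, p t i ω ≤ 1 := fun t ω =>
    (Finset.single_le_sum (f := fun t => ∑ i, p t i ω)
      (fun t _ => Finset.sum_nonneg fun i _ => hp0 t i ω) (Finset.mem_univ t)).trans (hsum ω)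
  have hp1 : ∀ t i ω, p t i ω ≤ 1 := fun t i ω => (Finset.single_le_sum (f := fun i => p t i ω)
      (fun i _ => hp0 t i ω) (Finset.mem_univ i)).trans (hPt t ω)
  have hpm : ∀ t i, Measurable (p t i) := fun t i => measurable_prob hx (fun j s _ => hM j s) i j s
  have hpi : ∀ t i, Integrable (p t i) P := fun t i => Integrable.of_bound
    (hpm t i).aestronglyMeasurable 1
    (ae_of_all _ fun ω => by rw [Real.norm_eq_abs, abs_of_nonneg (hp0 t i ω)]; exact hp1 t i ω)
  have hle : ∀ t, K.infoUpTo v t ≤ ‹MeasurableSpace Ω› := fun t => infoUpTo_le fun j s _ => hM j s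
  have hhm : ∀ t, Measurable (h t) := fun t =>
    (measurable_threshold_infoUpTo j s t).mono (hle t) le_rfl
  have hA : ∀ n ω, A n ω ∈ Set.Icc (0 : ℝ) 1 := fun n ω => survival_mem_Icc hp0 hPt ω n
  have hAm : ∀ n, Measurable (A n) := fun n =>
    measurable_survival n (fun t _ i => hpm t i) fun t _ => hhm t
  have hite : ∀ t i, Measurable fun ω => if h t ω ≤ K.r i j t s then (1 : ℝ) else 0 := fun t i =>
    Measurable.ite (measurableSet_le (hhm t) measurable_const) measurable_const measurable_const
  have hApi : ∀ (t : Fin T) i, Integrable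
      (fun ω => A t ω * p t i ω * if h t ω ≤ K.r i j t s then 1 else 0) P := fun t i => by
    refine Integrable.of_bound (((hAm t).mul (hpm t i)).mul (hite t i)).aestronglyMeasurable 1
      (ae_of_all _ fun ω => ?_)
    have h1 := mul_le_one₀ (hA t ω).2 (hp0 t i ω) (hp1 t i ω)
    have h0 := mul_nonneg (hA t ω).1 (hp0 t i ω)
    rw [Real.norm_eq_abs, abs_le]
    split_ifs <;> constructor <;> linarith
  have main := half_le_integral_survival (P := P) (infoUpTo_mono (K := K) (v := v)) hle
    (r := fun t i => K.r i j t s) (fun t i => K.r_nonneg i j t s) (p := p)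
    (fun t i => measurable_prob hx (fun j s hs => measurable_supplyArr_infoUpTo hs j) i j s) hp0
    hsum (h := h) (fun t => rfl)
  rw [integral_finsetSum _ fun t _ => integrable_finsetSum _ fun i _ => (hpi t i).const_mul _,
    integral_finsetSum _ fun t _ => integrable_finsetSum _ fun i _ => (hApi t i).const_mul _] at main
  simp only [integral_finsetSum _ fun i (_ : i ∈ Finset.univ) => (hpi _ i).const_mul _,
    integral_finsetSum _ fun i (_ : i ∈ Finset.univ) => (hApi _ i).const_mul _,
    integral_const_mul] at main
  refine main.trans (Finset.sum_le_sum fun t _ => Finset.sum_le_sum fun i _ => ?_)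
  let a : Ω → ℝ := fun ω => if h t ω ≤ K.r i j t s then 1 else 0
  let B : Ω → ℝ := fun ω => if K.Available P x u v w ω j s t then 1 else 0
  have ha0 : ∀ ω, 0 ≤ a ω := fun ω => by simp only [a]; split_ifs <;> simp
  have ha1 : ∀ ω, a ω ≤ 1 := fun ω => by simp only [a]; split_ifs <;> simp
  have ham : ∀ k, Measurable[seedAlg (Sum.elim u (Sum.elim v w)) (pastSeeds T k)] a :=
    fun k => Measurable.ite
      (measurableSet_le (measurable_threshold_seedAlg k j s t) measurable_const)
      measurable_const measurable_const
  have hBm : Measurable[seedAlg (Sum.elim u (Sum.elim v w)) (pastSeeds T t)] B :=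
    Measurable.ite (measurableSet_available hx j s t) measurable_const measurable_const
  -- Two exchanges follow: survival becomes availability under a weight depending on supply alone,
  -- then p becomes the pick indicator under a weight from the past.
  have h1 := integral_mul_survival_le hx hu hv hw hu_unif hw_unif hindep j s t
    (Z := fun ω => p t i ω * a ω) (C := 1) (fun ω => mul_nonneg (hp0 t i ω) (ha0 ω))
    (fun ω => mul_le_one₀ (hp1 t i ω) (ha0 ω) (ha1 ω))
    ((measurable_prob hx (fun j s _ => measurable_supplyArr_seedAlg 0 j s) i j s).mul (ham 0))
  have h2 := integral_mul_picked hx hu hv hw hu_unif hw_unif hindep (t := t)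
    (Z := fun ω => B ω * a ω) (C := 1)
    (fun ω => by simp only [a, B]; split_ifs <;> simp) (hBm.mul (ham t)) i j s
  calc K.r i j t s * ∫ ω, A t ω * p t i ω * (if h t ω ≤ K.r i j t s then 1 else 0) ∂P
      = K.r i j t s * ∫ ω, p t i ω * a ω * A t ω ∂P := by
        congr 1
        exact integral_congr_ae (ae_of_all _ fun ω => by simp only [a]; ring)
    _ ≤ K.r i j t s * ∫ ω, p t i ω * a ω * B ω ∂P :=
        mul_le_mul_of_nonneg_left h1 (K.r_nonneg i j t s)
    _ = K.r i j t s * ∫ ω, B ω * a ω * p t i ω ∂P := by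
        congr 1
        exact integral_congr_ae (ae_of_all _ fun ω => by ring)
    _ = ∫ ω, (if K.Matched P x u v w ω i j t s then K.r i j t s else 0) ∂P := by
        rw [← h2, ← integral_const_mul]
        refine integral_congr_ae (ae_of_all _ fun ω => ?_)
        simp only [B, a, h, Matched]
        split_ifs <;> simp_all

end Online

end Market

end

/-! ### Moments of the arrivals and the routing loss -/

noncomputable section

namespace Market

variable {I J T : ℕ} {K : Market I J T} {Ω : Type*} [MeasurableSpace Ω] {P : Measure Ω}
  [IsProbabilityMeasure P] {x : Fin I → Fin J → Fin T → Fin T → ℝ} {u v w : Fin T → Ω → ℝ}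

section Moments

variable {κ : Type*} {f : κ → Ω → ℝ} (hf : ∀ k, Measurable (f k)) (hindep : iIndepFun f P)
  {k : κ} (hunif : P.map (f k) = volume.restrict (Set.Icc 0 1))

include hf hindep hunif

lemma integral_mul_supplyArr {s : Fin T} (hk : f k = v s) {Z : Ω → ℝ} {C : ℝ}
    (hZ : Measurable[seedAlg f {k}ᶜ] Z) (hC : ∀ ω, |Z ω| ≤ C) (j : Fin J) :
    ∫ ω, Z ω * K.supplyArr v ω j s ∂P = (∫ ω, Z ω ∂P) * K.mu j s := by
  have := integral_mul_drawIndicator (seedAlg_le hf {k}ᶜ) (hf k) hunif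
    (indep_seedAlg hf hindep (by simp)) (q := fun _ j => K.mu j s) (fun _ => measurable_const)
    (fun _ j => (K.mu_pos j s).le) (fun _ => K.sum_mu_le_one s) hZ hC j
  rw [integral_mul_const, hk] at this
  exact this

lemma integral_mul_demandArr {t : Fin T} (hk : f k = u t) {Z : Ω → ℝ} {C : ℝ}
    (hZ : Measurable[seedAlg f {k}ᶜ] Z) (hC : ∀ ω, |Z ω| ≤ C) (i : Fin I) :
    ∫ ω, Z ω * K.demandArr u ω i t ∂P = (∫ ω, Z ω ∂P) * K.lam i t := by
  have := integral_mul_drawIndicator (seedAlg_le hf {k}ᶜ) (hf k) hunif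
    (indep_seedAlg hf hindep (by simp)) (q := fun _ i => K.lam i t) (fun _ => measurable_const)
    (fun _ i => (K.lam_pos i t).le) (fun _ => K.sum_lam_le_one t) hZ hC i
  rw [integral_mul_const, hk] at this
  exact this

end Moments

omit [MeasurableSpace Ω] in
lemma demandArr_nonneg (ω : Ω) (i t) : 0 ≤ K.demandArr u ω i t := drawIndicator_nonneg _ _ _

omit [MeasurableSpace Ω] in
lemma demandArr_le_one (ω : Ω) (i t) : K.demandArr u ω i t ≤ 1 := drawIndicator_le_one _ _ _

omit [MeasurableSpace Ω] in
lemma abs_supplyArr_le_one (ω : Ω) (j : Fin J) (s : Fin T) : |K.supplyArr v ω j s| ≤ 1 := by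
  rw [abs_of_nonneg (supplyArr_nonneg ω j s)]
  exact supplyArr_le_one ω j s

omit [MeasurableSpace Ω] in
lemma abs_demandArr_le_one (ω : Ω) (i : Fin I) (t : Fin T) : |K.demandArr u ω i t| ≤ 1 := by
  rw [abs_of_nonneg (demandArr_nonneg ω i t)]
  exact demandArr_le_one ω i t

variable (hu : ∀ t, Measurable (u t)) (hv : ∀ t, Measurable (v t)) (hw : ∀ t, Measurable (w t))
  (hu_unif : ∀ t, P.map (u t) = volume.restrict (Set.Icc 0 1))
  (hv_unif : ∀ t, P.map (v t) = volume.restrict (Set.Icc 0 1))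
  (hindep : iIndepFun (Sum.elim u (Sum.elim v w)) P)

include hu hv hw hindep

include hu_unif in
lemma integral_demandArr (i : Fin I) (t : Fin T) :
    ∫ ω, K.demandArr u ω i t ∂P = K.lam i t := by
  simpa using integral_mul_demandArr (K := K) (u := u) (measurable_seeds hu hv hw) hindep
    (k := Sum.inl t) (hu_unif t) rfl (Z := fun _ => 1) measurable_const (C := 1) (by simp) i

include hv_unif in
lemma integral_supplyArr (j : Fin J) (s : Fin T) :
    ∫ ω, K.supplyArr v ω j s ∂P = K.mu j s := by
  simpa using integral_mul_supplyArr (K := K) (v := v) (measurable_seeds hu hv hw) hindep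
    (k := Sum.inr (Sum.inl s)) (hv_unif s) rfl (Z := fun _ => 1) measurable_const (C := 1)
    (by simp) j

include hu_unif hv_unif in
lemma integral_demandArr_mul_supplyArr (i : Fin I) (j : Fin J) (t s : Fin T) :
    ∫ ω, K.demandArr u ω i t * K.supplyArr v ω j s ∂P = K.lam i t * K.mu j s := by
  rw [integral_mul_supplyArr (K := K) (v := v) (measurable_seeds hu hv hw) hindep
    (k := Sum.inr (Sum.inl s)) (hv_unif s) rfl (Z := fun ω => K.demandArr u ω i t)
    (measurable_demandArr (measurable_seedAlg (Sum.elim u (Sum.elim v w)) (k := Sum.inl t)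
      (by simp)) i) (C := 1) (fun ω => abs_demandArr_le_one ω i t) j,
    integral_demandArr hu hv hw hu_unif hindep]

include hv_unif in
lemma integral_supplyArr_mul_supplyArr_of_ne (j j' : Fin J) {s s' : Fin T} (hs : s ≠ s') :
    ∫ ω, K.supplyArr v ω j s * K.supplyArr v ω j' s' ∂P = K.mu j s * K.mu j' s' := by
  rw [integral_mul_supplyArr (K := K) (v := v) (measurable_seeds hu hv hw) hindep
    (k := Sum.inr (Sum.inl s')) (hv_unif s') rfl (Z := fun ω => K.supplyArr v ω j s)
    (measurable_supplyArr (measurable_seedAlg (Sum.elim u (Sum.elim v w))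
      (k := Sum.inr (Sum.inl s)) (by simpa using hs)) j) (C := 1)
    (fun ω => abs_supplyArr_le_one ω j s) j',
    integral_supplyArr hu hv hw hv_unif hindep]

include hv_unif in
/-- Given that supply unit `(j,s)` arrives, the expected routing mass of any demand unit is at most
twice its arrival probability. -/
lemma integral_supplyArr_mul_routingMass_le (hx : AssignmentFeasible K.lam K.mu x)
    (i : Fin I) (j : Fin J) (t s : Fin T) :
    ∫ ω, K.supplyArr v ω j s * K.routingMass x (K.supplyArr v ω) i t ∂P ≤
      2 * (K.lam i t * K.mu j s) := by
  have hM : ∀ j s, Measurable fun ω => K.supplyArr v ω j s := fun j s =>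
    measurable_supplyArr (hv s) j
  have hMM : ∀ j' s', Integrable (fun ω => K.supplyArr v ω j s * K.supplyArr v ω j' s') P :=
    fun j' s' => Integrable.of_bound ((hM j s).mul (hM j' s')).aestronglyMeasurable 1
      (ae_of_all _ fun ω => by
        rw [Real.norm_eq_abs, abs_mul]
        exact mul_le_one₀ (abs_supplyArr_le_one ω j s) (abs_nonneg _)
          (abs_supplyArr_le_one ω j' s'))
  have hmu := (K.mu_pos j s).le
  -- Different periods are independent, different types in one period exclude each other, and a unit
  -- paired with itself has M² = M; only this last case contributes the extra term.
  have hterm : ∀ j' s', (∫ ω, K.supplyArr v ω j s * K.supplyArr v ω j' s' ∂P) *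
      (x i j' t s' / K.mu j' s') ≤
      K.mu j s * x i j' t s' + if j' = j then (if s' = s then x i j t s else 0) else 0 := by
    intro j' s'
    have hx0 := hx.nonneg i j' t s'
    have hmu' := K.mu_pos j' s'
    by_cases hs : s = s'
    · subst hs
      by_cases hj : j = j'
      · subst hj
        have : ∀ ω, K.supplyArr v ω j s * K.supplyArr v ω j s = K.supplyArr v ω j s := fun ω =>
          drawIndicator_mul_self _ _ _
        simp only [this, integral_supplyArr hu hv hw hv_unif hindep, if_true]
        rw [mul_div_cancel₀ _ hmu'.ne']
        nlinarith
      · have : ∀ ω, K.supplyArr v ω j s * K.supplyArr v ω j' s = 0 := fun ω =>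
          drawIndicator_mul_eq_zero (fun j => (K.mu_pos j s).le) hj _
        simp only [this, integral_zero, zero_mul, Ne.symm hj, if_false, add_zero]
        positivity
    · rw [integral_supplyArr_mul_supplyArr_of_ne hu hv hw hv_unif hindep j j' hs, mul_assoc,
        mul_div_cancel₀ _ hmu'.ne', if_neg (Ne.symm hs), ite_self, add_zero]
  calc ∫ ω, K.supplyArr v ω j s * K.routingMass x (K.supplyArr v ω) i t ∂P
      = ∫ ω, ∑ j', ∑ s' ∈ Finset.Iic t, K.supplyArr v ω j s * K.supplyArr v ω j' s' *
          (x i j' t s' / K.mu j' s') ∂P := by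
        simp only [routingMass, Finset.mul_sum, mul_assoc]
    _ = ∑ j', ∑ s' ∈ Finset.Iic t, (∫ ω, K.supplyArr v ω j s * K.supplyArr v ω j' s' ∂P) *
          (x i j' t s' / K.mu j' s') := by
        rw [integral_finsetSum _ fun j' _ => integrable_finsetSum _ fun s' _ =>
          (hMM j' s').mul_const _]
        refine Finset.sum_congr rfl fun j' _ => ?_
        rw [integral_finsetSum _ fun s' _ => (hMM j' s').mul_const _]
        simp only [integral_mul_const]
    _ ≤ ∑ j', ∑ s', (∫ ω, K.supplyArr v ω j s * K.supplyArr v ω j' s' ∂P) *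
          (x i j' t s' / K.mu j' s') :=
        Finset.sum_le_sum fun j' _ => Finset.sum_le_univ_sum_of_nonneg fun s' =>
          mul_nonneg (integral_nonneg fun ω =>
            mul_nonneg (supplyArr_nonneg ω j s) (supplyArr_nonneg ω j' s'))
            (route_nonneg hx i j' t s')
    _ ≤ ∑ j', ∑ s', (K.mu j s * x i j' t s' +
          if j' = j then (if s' = s then x i j t s else 0) else 0) :=
        Finset.sum_le_sum fun j' _ => Finset.sum_le_sum fun s' _ => hterm j' s'
    _ = K.mu j s * (∑ j', ∑ s', x i j' t s') + x i j t s := by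
        simp only [Finset.sum_add_distrib, Finset.mul_sum]
        congr 1
        rw [Finset.sum_eq_single j (by simp +contextual) (by simp)]
        simp
    _ ≤ 2 * (K.lam i t * K.mu j s) := by
        -- The demand constraint bounds the first term by λμ and the pair constraint bounds the
        -- second by λμ, whence the factor 2.
        have := mul_le_mul_of_nonneg_left (hx.demand i t) hmu
        linarith [hx.pair i j t s]

include hv_unif in
/-- The expected routing probability is at least half of the LP solution. -/
lemma half_le_integral_prob (hx : AssignmentFeasible K.lam K.mu x)
    (i : Fin I) (j : Fin J) (t s : Fin T) :
    1 / 2 * x i j t s ≤ ∫ ω, K.prob x (K.supplyArr v ω) i j t s ∂P := by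
  have hM : ∀ j s, Measurable fun ω => K.supplyArr v ω j s := fun j s =>
    measurable_supplyArr (hv s) j
  have hMi : ∀ j s, Integrable (fun ω => K.supplyArr v ω j s) P := fun j s =>
    Integrable.of_bound (hM j s).aestronglyMeasurable 1
      (ae_of_all _ fun ω => abs_supplyArr_le_one ω j s)
  have hQi : Integrable (fun ω => K.routingMass x (K.supplyArr v ω) i t) P :=
    integrable_finsetSum _ fun j' _ => integrable_finsetSum _ fun s' _ => (hMi j' s').mul_const _
  have hMQi : Integrable
      (fun ω => K.supplyArr v ω j s * K.routingMass x (K.supplyArr v ω) i t) P :=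
    hQi.bdd_mul (hM j s).aestronglyMeasurable (ae_of_all _ fun ω => abs_supplyArr_le_one ω j s)
  have hpi : Integrable (fun ω => K.prob x (K.supplyArr v ω) i j t s) P := by
    refine Integrable.mono' ((hMi j s).mul_const (x i j t s / K.mu j s))
      (measurable_prob hx (fun j s _ => hM j s) i j s).aestronglyMeasurable
      (ae_of_all _ fun ω => ?_)
    rw [Real.norm_eq_abs, abs_of_nonneg (prob_nonneg hx (supplyArr_nonneg ω) i j t s)]
    exact prob_le hx (supplyArr_nonneg ω) i j t s
  have hl := K.lam_pos i t
  have hmu := K.mu_pos j s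
  have hc := route_nonneg hx i j t s
  have hb := integral_supplyArr_mul_routingMass_le hu hv hw hv_unif hindep hx i j t s
  calc 1 / 2 * x i j t s
      = x i j t s / K.mu j s * (K.mu j s - 2 * (K.lam i t * K.mu j s) / (4 * K.lam i t)) := by
        field_simp; ring
    _ ≤ x i j t s / K.mu j s * (K.mu j s -
          (∫ ω, K.supplyArr v ω j s * K.routingMass x (K.supplyArr v ω) i t ∂P) /
            (4 * K.lam i t)) := by
        gcongr
    _ = ∫ ω, x i j t s / K.mu j s * (K.supplyArr v ω j s -
          K.supplyArr v ω j s * K.routingMass x (K.supplyArr v ω) i t / (4 * K.lam i t)) ∂P := by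
        rw [integral_const_mul, integral_sub (hMi j s) (hMQi.div_const _), integral_div,
          integral_supplyArr hu hv hw hv_unif hindep]
    _ ≤ ∫ ω, K.prob x (K.supplyArr v ω) i j t s ∂P := by
        refine integral_mono (((hMi j s).sub (hMQi.div_const _)).const_mul _) hpi fun ω => ?_
        refine le_trans (le_of_eq ?_) (le_prob hx (supplyArr_nonneg ω) i j t s)
        ring

/-! ### The deterministic program as an upper bound -/

-- Solutions within ε of the supremum are enough for the averaging argument, so attainment is never
-- needed.
omit hu hv hw hindep [MeasurableSpace Ω] [IsProbabilityMeasure P] in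
lemma exists_feasible_offValue_sub_le {a : Fin I → Fin T → ℝ} {b : Fin J → Fin T → ℝ}
    (ha : ∀ i t, 0 ≤ a i t) (hb : ∀ j s, 0 ≤ b j s) {ε : ℝ} (hε : 0 < ε) :
    ∃ y, AssignmentFeasible a b y ∧ K.offValue a b - ε ≤ K.objective y := by
  have hne : {c | ∃ x, AssignmentFeasible a b x ∧ c = K.objective x}.Nonempty :=
    ⟨_, fun _ _ _ _ => 0, ⟨fun j s => by simpa using hb j s, fun i t => by simpa using ha i t,
      fun i j t s => mul_nonneg (ha i t) (hb j s), fun _ _ _ _ _ => rfl, fun _ _ _ _ => le_rfl⟩,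
      rfl⟩
  obtain ⟨_, ⟨y, hy, rfl⟩, hlt⟩ := exists_lt_of_lt_csSup hne (sub_lt_self _ hε)
  exact ⟨y, hy, hlt.le⟩

-- The arrivals take finitely many values, so they factor through a finite Boolean type and `G` may
-- be arbitrary. This covers the offline value and near-optimal solutions picked by choice.
omit hw hindep in
lemma integrable_comp_arrivals (G : (Fin I → Fin T → ℝ) × (Fin J → Fin T → ℝ) → ℝ) :
    Integrable (fun ω => G (K.demandArr u ω, K.supplyArr v ω)) P := by
  let dec : Bool → ℝ := fun b => if b then 1 else 0
  let ξ : Ω → (Fin I → Fin T → Bool) × (Fin J → Fin T → Bool) := fun ω =>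
    (fun i t => decide (K.demandArr u ω i t = 1), fun j s => decide (K.supplyArr v ω j s = 1))
  have hξ : Measurable ξ := by
    refine Measurable.prodMk ?_ ?_
    · refine measurable_pi_iff.2 fun i => measurable_pi_iff.2 fun t => measurable_to_bool ?_
      simpa [Set.preimage] using
        measurable_demandArr (K := K) (hu t) i (measurableSet_singleton 1)
    · refine measurable_pi_iff.2 fun j => measurable_pi_iff.2 fun s => measurable_to_bool ?_
      simpa [Set.preimage] using
        measurable_supplyArr (K := K) (hv s) j (measurableSet_singleton 1)
  have hdec : ∀ {y : ℝ}, y = 0 ∨ y = 1 → dec (decide (y = 1)) = y := by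
    rintro y (rfl | rfl) <;> simp [dec]
  let g : (Fin I → Fin T → Bool) × (Fin J → Fin T → Bool) → ℝ := fun z =>
    G (fun i t => dec (z.1 i t), fun j s => dec (z.2 j s))
  have : IsProbabilityMeasure (P.map ξ) := Measure.isProbabilityMeasure_map hξ.aemeasurable
  have hg : Integrable g (P.map ξ) := Integrable.of_finite
  have := hg.comp_measurable hξ
  refine this.congr (ae_of_all _ fun ω => ?_)
  simp only [g, ξ, Function.comp]
  congr 2
  · funext i t; exact hdec (drawIndicator_eq_zero_or_one _ _ _)
  · funext j s; exact hdec (drawIndicator_eq_zero_or_one _ _ _)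

include hu_unif hv_unif in
/-- The deterministic program bounds the expected offline reward. -/
lemma integral_rewardOff_le (hx : K.IsOptimal x) :
    ∫ ω, K.rewardOff u v ω ∂P ≤ K.objective x := by
  refine le_of_forall_pos_le_add fun ε hε => ?_
  -- The solution is chosen as a function of the arrival pattern rather than of ω, which makes it
  -- integrable.
  have hex : ∀ z : (Fin I → Fin T → ℝ) × (Fin J → Fin T → ℝ),
      ∃ y, ((∀ i t, 0 ≤ z.1 i t) ∧ ∀ j s, 0 ≤ z.2 j s) →
        AssignmentFeasible z.1 z.2 y ∧ K.offValue z.1 z.2 - ε ≤ K.objective y := fun z => by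
    by_cases hz : (∀ i t, 0 ≤ z.1 i t) ∧ ∀ j s, 0 ≤ z.2 j s
    · obtain ⟨y, hy⟩ := exists_feasible_offValue_sub_le (K := K) hz.1 hz.2 hε
      exact ⟨y, fun _ => hy⟩
    · exact ⟨0, fun h => (hz h).elim⟩
  choose y hy using hex
  let Y : Fin I → Fin J → Fin T → Fin T → Ω → ℝ := fun i j t s ω =>
    y (K.demandArr u ω, K.supplyArr v ω) i j t s
  have hY : ∀ ω, AssignmentFeasible (K.demandArr u ω) (K.supplyArr v ω) (fun i j t s => Y i j t s ω)
      ∧ K.rewardOff u v ω - ε ≤ K.objective (fun i j t s => Y i j t s ω) := fun ω =>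
    hy (K.demandArr u ω, K.supplyArr v ω) ⟨demandArr_nonneg ω, supplyArr_nonneg ω⟩
  have hYi : ∀ i j t s, Integrable (Y i j t s) P := fun i j t s =>
    integrable_comp_arrivals hu hv fun z => y z i j t s
  have hdi : ∀ i t, Integrable (fun ω => K.demandArr u ω i t) P := fun i t =>
    integrable_comp_arrivals (J := J) hu hv fun z => z.1 i t
  have hsi : ∀ j s, Integrable (fun ω => K.supplyArr v ω j s) P := fun j s =>
    integrable_comp_arrivals (I := I) hu hv fun z => z.2 j s
  have hdsi : ∀ i j t s, Integrable (fun ω => K.demandArr u ω i t * K.supplyArr v ω j s) P :=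
    fun i j t s => integrable_comp_arrivals hu hv fun z => z.1 i t * z.2 j s
  have hoff : Integrable (K.rewardOff u v) P :=
    integrable_comp_arrivals hu hv fun z => K.offValue z.1 z.2
  have hfeas : AssignmentFeasible K.lam K.mu (fun i j t s => ∫ ω, Y i j t s ω ∂P) := by
    refine ⟨fun j s => ?_, fun i t => ?_, fun i j t s => ?_, fun i j t s hts => ?_,
      fun i j t s => integral_nonneg fun ω => (hY ω).1.nonneg i j t s⟩
    · simp only [← integral_finsetSum _ fun t (_ : t ∈ Finset.univ) => hYi _ j t s]
      rw [← integral_finsetSum _ fun i _ => integrable_finsetSum _ fun t _ => hYi i j t s,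
        ← integral_supplyArr (K := K) hu hv hw hv_unif hindep j s]
      exact integral_mono (integrable_finsetSum _ fun i _ => integrable_finsetSum _ fun t _ =>
        hYi i j t s) (hsi j s) fun ω => (hY ω).1.supply j s
    · simp only [← integral_finsetSum _ fun s (_ : s ∈ Finset.univ) => hYi i _ t s]
      rw [← integral_finsetSum _ fun j _ => integrable_finsetSum _ fun s _ => hYi i j t s,
        ← integral_demandArr (K := K) hu hv hw hu_unif hindep i t]
      exact integral_mono (integrable_finsetSum _ fun j _ => integrable_finsetSum _ fun s _ =>
        hYi i j t s) (hdi i t) fun ω => (hY ω).1.demand i t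
    -- The pair constraint is nonlinear in the capacities; it passes to the mean because
    -- independence gives E[ΛM] = λμ.
    · rw [← integral_demandArr_mul_supplyArr (K := K) hu hv hw hu_unif hv_unif hindep i j t s]
      exact integral_mono (hYi i j t s) (hdsi i j t s) fun ω => (hY ω).1.pair i j t s
    · have : ∀ ω, Y i j t s ω = 0 := fun ω => (hY ω).1.causal i j t s hts
      simp [this]
  have hobj : ∫ ω, K.objective (fun i j t s => Y i j t s ω) ∂P =
      K.objective (fun i j t s => ∫ ω, Y i j t s ω ∂P) := by
    simp only [objective]
    rw [integral_finsetSum _ fun i _ => integrable_finsetSum _ fun j _ => integrable_finsetSum _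
      fun t _ => integrable_finsetSum _ fun s _ => (hYi i j t s).mul_const _]
    refine Finset.sum_congr rfl fun i _ => ?_
    rw [integral_finsetSum _ fun j _ => integrable_finsetSum _
      fun t _ => integrable_finsetSum _ fun s _ => (hYi i j t s).mul_const _]
    refine Finset.sum_congr rfl fun j _ => ?_
    rw [integral_finsetSum _ fun t _ => integrable_finsetSum _ fun s _ =>
      (hYi i j t s).mul_const _]
    refine Finset.sum_congr rfl fun t _ => ?_
    rw [integral_finsetSum _ fun s _ => (hYi i j t s).mul_const _]
    simp only [integral_mul_const]
  have hobji : Integrable (fun ω => K.objective (fun i j t s => Y i j t s ω)) P :=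
    integrable_finsetSum _ fun i _ => integrable_finsetSum _ fun j _ => integrable_finsetSum _
      fun t _ => integrable_finsetSum _ fun s _ => (hYi i j t s).mul_const _
  have hle := integral_mono (hoff.sub (integrable_const ε)) hobji fun ω => (hY ω).2
  rw [integral_sub' hoff (integrable_const ε), integral_const, probReal_univ, one_smul] at hle
  linarith [hx.2 _ hfeas]

end Market

end

theorem mainTheorem5 {I J T : ℕ} (K : Market I J T)
    (x : Fin I → Fin J → Fin T → Fin T → ℝ) (hx : K.IsOptimal x)
    {Ω : Type*} [MeasurableSpace Ω] (P : Measure Ω) [IsProbabilityMeasure P]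
    (u v w : Fin T → Ω → ℝ)
    (hu : ∀ t, Measurable (u t)) (hv : ∀ t, Measurable (v t)) (hw : ∀ t, Measurable (w t))
    (hu_unif : ∀ t, P.map (u t) = volume.restrict (Set.Icc 0 1))
    (hv_unif : ∀ t, P.map (v t) = volume.restrict (Set.Icc 0 1))
    (hw_unif : ∀ t, P.map (w t) = volume.restrict (Set.Icc 0 1))
    (hindep : iIndepFun (Sum.elim u (Sum.elim v w)) P) :
    Integrable (K.rewardOn P x u v w) P ∧ Integrable (K.rewardOff u v) P ∧
      (∫ ω, K.rewardOn P x u v w ω ∂P) ≥ (1 / 4) * ∫ ω, K.rewardOff u v ω ∂P := by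
  classical
  let V : Fin I → Fin J → Fin T → Fin T → Ω → ℝ := fun i j t s ω =>
    if K.Matched P x u v w ω i j t s then K.r i j t s else 0
  have hV : ∀ i j t s, Integrable (V i j t s) P := fun i j t s =>
    Market.integrable_matched hx.1 hu hv hw i j t s
  have hon : K.rewardOn P x u v w = fun ω => ∑ i, ∑ j, ∑ t, ∑ s, V i j t s ω := rfl
  refine ⟨?_, Market.integrable_comp_arrivals hu hv fun z => K.offValue z.1 z.2, ?_⟩
  · rw [hon]
    exact integrable_finsetSum _ fun i _ => integrable_finsetSum _ fun j _ =>
      integrable_finsetSum _ fun t _ => integrable_finsetSum _ fun s _ => hV i j t s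
  have hint : ∫ ω, K.rewardOn P x u v w ω ∂P = ∑ i, ∑ j, ∑ t, ∑ s, ∫ ω, V i j t s ω ∂P := by
    rw [hon, integral_finsetSum _ fun i _ => integrable_finsetSum _ fun j _ =>
      integrable_finsetSum _ fun t _ => integrable_finsetSum _ fun s _ => hV i j t s]
    refine Finset.sum_congr rfl fun i _ => ?_
    rw [integral_finsetSum _ fun j _ =>
      integrable_finsetSum _ fun t _ => integrable_finsetSum _ fun s _ => hV i j t s]
    refine Finset.sum_congr rfl fun j _ => ?_
    rw [integral_finsetSum _ fun t _ => integrable_finsetSum _ fun s _ => hV i j t s]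
    refine Finset.sum_congr rfl fun t _ => ?_
    rw [integral_finsetSum _ fun s _ => hV i j t s]
  have hswap : ∀ F : Fin I → Fin J → Fin T → Fin T → ℝ,
      ∑ i, ∑ j, ∑ t, ∑ s, F i j t s = ∑ j, ∑ s, ∑ t, ∑ i, F i j t s := fun F => by
    rw [Finset.sum_comm]
    refine Finset.sum_congr rfl fun j _ => ?_
    rw [Finset.sum_comm' (s' := fun _ => Finset.univ) (t' := Finset.univ) (by simp)]
    rw [Finset.sum_congr rfl fun t _ => Finset.sum_comm, Finset.sum_comm]
  have hoff := Market.integral_rewardOff_le hu hv hw hu_unif hv_unif hindep hx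
  calc 1 / 4 * ∫ ω, K.rewardOff u v ω ∂P ≤ 1 / 4 * K.objective x := by linarith
    -- Grouped by supply unit, 1/4 splits into an outer 1/2 for the thresholds and an inner 1/2 for
    -- the routing.
    _ = ∑ j, ∑ s, 1 / 2 * ∑ t, ∑ i, K.r i j t s * (1 / 2 * x i j t s) := by
        rw [Market.objective, hswap]
        simp only [Finset.mul_sum]
        refine Finset.sum_congr rfl fun j _ => Finset.sum_congr rfl fun s _ =>
          Finset.sum_congr rfl fun t _ => Finset.sum_congr rfl fun i _ => ?_
        ring
    _ ≤ ∑ j, ∑ s, ∑ t, ∑ i, ∫ ω, V i j t s ω ∂P := by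
        refine Finset.sum_le_sum fun j _ => Finset.sum_le_sum fun s _ => le_trans ?_
          (Market.half_routed_le_integral_matched hx.1 hu hv hw hu_unif hw_unif hindep j s)
        gcongr with t _ i _
        · exact K.r_nonneg i j t s
        · exact Market.half_le_integral_prob hu hv hw hv_unif hindep hx.1 i j t s
    _ = ∫ ω, K.rewardOn P x u v w ω ∂P := by rw [hint, hswap]
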